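/- Let $f_0,\dots,f_{m-1}$ be contractive similitudes of $\mathbb{R}^n$ with contraction ratios $r_i\in(0,1)$, let $E$ be the self-similar set they generate (the nonempty compact set with $E=\bigcup_i f_i(E)$), and let $s>0$ be its similarity dimension, $\sum_i r_i^s=1$. A feasible open set is an open set $\mathcal{O}\subset\mathbb{R}^n$ with $f_i(\mathcal{O})\subset\mathcal{O}$ for all $i$, $f_i(\mathcal{O})\cap f_j(\mathcal{O})=\varnothing$ for $i\ne j$, and $\mathcal{O}\cap E\neq\varnothing$. Suppose that a feasible open set exists (the strong open set condition), and fix one, $\mathcal{O}$. Let $\mu$ be the natural probability measure on $E$, i.e. the compactly supported Borel probability measure with $\mu=\sum_i r_i^s\,\mu\circ f_i^{-1}$. Let $B(x,d)$ denote the closed ball with centre $x$ and radius $d>0$. For $A\subset\mathbb{R}^n$ let $\mathcal{H}^s(A)$ be the Hausdorff measure, $\lim_{\delta\to0}\inf\sum_i|U_i|^s$ over countable coverings of $A$ by sets $U_i$ of diameter $|U_i|\le\delta$; let $\mathcal{H}^s_{Sph}(A)$ be the spherical Hausdorff measure, $\lim_{\delta\to0}\inf\sum_i(2d_i)^s$ over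 countable coverings of $A$ by balls $B(x_i,d_i)$ with $2d_i\le\delta$; let $C^s(A)=\sup\{C^s_0(F):F\subset A\text{ closed}\}$ be the centred Hausdorff measure, where $C^s_0(F)$ is defined like $\mathcal{H}^s_{Sph}(F)$ but with all centres $x_i\in F$; and let $P^s(A)=\inf\{\sum_i P^s_0(F_i):A\subset\bigcup_{i}F_i,\ F_i\text{ closed}\}$ (countable coverings) be the packing measure, where $P^s_0(F)=\lim_{\delta\to0}\sup\sum_i(2d_i)^s$ over countable families of pairwise disjoint balls $B(x_i,d_i)$ with $x_i\in F$ and $2d_i\le\delta$. Let $\alpha$ be one of $\mu$, $\mathcal{H}^s\lfloor_E$, $\mathcal{H}^s_{Sph}\lfloor_E$, $C^s\lfloor_E$, $P^s\lfloor_E$, where $\beta\lfloor_E(A)=\beta(A\cap E)$. Put $\theta^s_\alpha(x,d)=\alpha(B(x,d))/(2d)^s$, $\underline\theta^s_\alpha(x)=\liminf_{d\to0^+}\theta^s_\alpha(x,d)$, $\overline\theta^s_\alpha(x)=\limsup_{d\to0^+}\theta^s_\alpha(x,d)$. For $A\subset\mathbb{R}^n$ let $Spec(\alpha,A)$ be the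 set of all limits $\lim_{k\to\infty}\theta^s_\alpha(x,d_k)$ with $x\in A$, $d_k>0$ and $d_k\to0$, and write $Spec(\alpha,x)=Spec(\alpha,\{x\})$. Call $B(x,d)$ a typical ball if $x\in E$ and $B(x,d)$ is contained in some feasible open set; let $\mathcal{B}$ be the set of typical balls and $\mathit{Im}(\theta^s_\alpha,\mathcal{B})=\{\theta^s_\alpha(x,d):B(x,d)\in\mathcal{B}\}$. Then: (i) For every $x\in E$, $Spec(\alpha,x)=[\underline\theta^s_\alpha(x),\overline\theta^s_\alpha(x)]$; and there are $0<\kappa_1\le\kappa_2<\infty$ with $Spec(\alpha,E)\subset[\kappa_1,\kappa_2]$. (ii) There is a (Borel) set $\widehat{E}\subset E$ with $\mu(\widehat{E})=1$ such that, for every $y\in\widehat{E}$, $Spec(\alpha,y)=Spec(\alpha,\widehat{E})=Spec(\alpha,\mathcal{O}\cap E)$. (iii) $$\left(\frac{\alpha(E)}{P^s(E)},\frac{\alpha(E)}{C^s(E)}\right)\subset\mathit{Im}(\theta^s_\alpha,\mathcal{B})\subset Spec(\alpha,\mathcal{O}\cap E)\subset\left[\frac{\alpha(E)}{P^s(E)},\frac{\alpha(E)}{C^s(E)}\right].$$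 -/

import Mathlib

open Set Filter MeasureTheory
open scoped ENNReal Topology

namespace SelfSimilarSpectrum

/-! ### Self-similar systems -/

/-- `f` is a finite system of contractive similitudes with contraction ratios `r`. -/
def IsSimilitudeSystem {n m : ℕ}
    (f : Fin m → EuclideanSpace ℝ (Fin n) → EuclideanSpace ℝ (Fin n)) (r : Fin m → ℝ) : Prop :=
  ∀ i, 0 < r i ∧ r i < 1 ∧ ∀ x y, dist (f i x) (f i y) = r i * dist x y

/-- `E` is the self-similar set generated by `f`: the nonempty compact set that is the union of
its images. -/
structure IsSelfSimilarSet {n m : ℕ}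
    (f : Fin m → EuclideanSpace ℝ (Fin n) → EuclideanSpace ℝ (Fin n))
    (E : Set (EuclideanSpace ℝ (Fin n))) : Prop where
  isCompact : IsCompact E
  nonempty : E.Nonempty
  eq_iUnion : E = ⋃ i, f i '' E

/-- `O` is a feasible open set for `f` and `E` (strong open set condition). -/
structure IsFeasible {n m : ℕ}
    (f : Fin m → EuclideanSpace ℝ (Fin n) → EuclideanSpace ℝ (Fin n))
    (E O : Set (EuclideanSpace ℝ (Fin n))) : Prop where
  isOpen : IsOpen O
  image_subset : ∀ i, f i '' O ⊆ O
  disjoint : ∀ i j, i ≠ j → Disjoint (f i '' O) (f j '' O)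
  inter_nonempty : (O ∩ E).Nonempty

/-- The closed ball `B(x, d)` is a typical ball: it is centred in `E` and contained in some
feasible open set. -/
def IsTypicalBall {n m : ℕ}
    (f : Fin m → EuclideanSpace ℝ (Fin n) → EuclideanSpace ℝ (Fin n))
    (E : Set (EuclideanSpace ℝ (Fin n))) (x : EuclideanSpace ℝ (Fin n)) (d : ℝ) : Prop :=
  x ∈ E ∧ 0 < d ∧ ∃ O, IsFeasible f E O ∧ Metric.closedBall x d ⊆ O

/-- `μ` is the natural probability measure: the compactly supported Borel probability measure
with `μ = ∑ i, (r i) ^ s • (f i)_♯ μ`. -/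
structure IsNaturalMeasure {n m : ℕ}
    (f : Fin m → EuclideanSpace ℝ (Fin n) → EuclideanSpace ℝ (Fin n)) (r : Fin m → ℝ) (s : ℝ)
    (μ : Measure (EuclideanSpace ℝ (Fin n))) : Prop where
  isProbabilityMeasure : IsProbabilityMeasure μ
  compactly_supported : ∃ K, IsCompact K ∧ μ Kᶜ = 0
  invariant : μ = ∑ i, ENNReal.ofReal (r i ^ s) • μ.map (f i)

/-! ### Metric measures

A countable family of closed balls is recorded as a countable set of pairs (centre, radius). -/

/-- A countable family of balls with positive radii and diameters `2 d ≤ δ`. -/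
def IsBallFamily {X : Type*} (δ : ℝ) (T : Set (X × ℝ)) : Prop :=
  T.Countable ∧ ∀ p ∈ T, 0 < p.2 ∧ 2 * p.2 ≤ δ

/-- The sum of `(2 d) ^ s` over the family. -/
noncomputable def ballSum {X : Type*} (s : ℝ) (T : Set (X × ℝ)) : ℝ≥0∞ :=
  ∑' p : T, ENNReal.ofReal (2 * (p : X × ℝ).2) ^ s

/-- The balls of the family cover `A`. -/
def Covers {X : Type*} [PseudoMetricSpace X] (T : Set (X × ℝ)) (A : Set X) : Prop :=
  A ⊆ ⋃ p ∈ T, Metric.closedBall p.1 p.2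

/-- The spherical Hausdorff measure `H_Sph^s`. -/
noncomputable def sphericalHausdorff {X : Type*} [PseudoMetricSpace X] (s : ℝ) (A : Set X) :
    ℝ≥0∞ :=
  ⨆ (δ : ℝ) (_ : 0 < δ), ⨅ (T : Set (X × ℝ)) (_ : IsBallFamily δ T ∧ Covers T A), ballSum s T

/-- The centred Hausdorff premeasure `C_0^s`: coverings of `A` by balls centred at points of
`A`. -/
noncomputable def centredPre {X : Type*} [PseudoMetricSpace X] (s : ℝ) (A : Set X) : ℝ≥0∞ :=
  ⨆ (δ : ℝ) (_ : 0 < δ), ⨅ (T : Set (X × ℝ))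
    (_ : IsBallFamily δ T ∧ (∀ p ∈ T, p.1 ∈ A) ∧ Covers T A), ballSum s T

/-- The centred Hausdorff measure `C^s`. -/
noncomputable def centredHausdorff {X : Type*} [PseudoMetricSpace X] (s : ℝ) (A : Set X) :
    ℝ≥0∞ :=
  ⨆ (F : Set X) (_ : F ⊆ A ∧ IsClosed F), centredPre s F

/-- The packing premeasure `P_0^s`: packings by pairwise disjoint closed balls centred at points
of `A`. -/
noncomputable def packingPre {X : Type*} [PseudoMetricSpace X] (s : ℝ) (A : Set X) : ℝ≥0∞ :=
  ⨅ (δ : ℝ) (_ : 0 < δ), ⨆ (T : Set (X × ℝ))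
    (_ : IsBallFamily δ T ∧ (∀ p ∈ T, p.1 ∈ A) ∧
      T.PairwiseDisjoint fun p => Metric.closedBall p.1 p.2), ballSum s T

/-- The packing measure `P^s`. -/
noncomputable def packingMeasure {X : Type*} [PseudoMetricSpace X] (s : ℝ) (A : Set X) : ℝ≥0∞ :=
  ⨅ (F : ℕ → Set X) (_ : (∀ i, IsClosed (F i)) ∧ A ⊆ ⋃ i, F i), ∑' i, packingPre s (F i)

/-- The family `{μ, H^s⌊E, H_Sph^s⌊E, C^s⌊E, P^s⌊E}`. Its members are given through their values
on sets; `β⌊E` is `A ↦ β (A ∩ E)`. -/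
noncomputable def metricMeasures {n : ℕ} (s : ℝ) (E : Set (EuclideanSpace ℝ (Fin n)))
    (μ : Measure (EuclideanSpace ℝ (Fin n))) : Set (Set (EuclideanSpace ℝ (Fin n)) → ℝ≥0∞) :=
  {fun A => μ A,
   fun A => Measure.hausdorffMeasure s (A ∩ E),
   fun A => sphericalHausdorff s (A ∩ E),
   fun A => centredHausdorff s (A ∩ E),
   fun A => packingMeasure s (A ∩ E)}

/-! ### Densities and spectra -/

/-- The density `θ_α^s(x, d) = α(B(x, d)) / (2 d) ^ s`, for `d > 0`. -/
noncomputable def density {X : Type*} [PseudoMetricSpace X] (α : Set X → ℝ≥0∞) (s : ℝ) (x : X)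
    (d : ℝ) : ℝ≥0∞ :=
  α (Metric.closedBall x d) / ENNReal.ofReal (2 * d) ^ s

/-- The lower spherical `s`-density at `x`. -/
noncomputable def lowerDensity {X : Type*} [PseudoMetricSpace X] (α : Set X → ℝ≥0∞) (s : ℝ)
    (x : X) : ℝ≥0∞ :=
  liminf (fun d : ℝ => density α s x d) (𝓝[>] 0)

/-- The upper spherical `s`-density at `x`. -/
noncomputable def upperDensity {X : Type*} [PseudoMetricSpace X] (α : Set X → ℝ≥0∞) (s : ℝ)
    (x : X) : ℝ≥0∞ :=
  limsup (fun d : ℝ => density α s x d) (𝓝[>] 0)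

/-- The asymptotic spectrum `Spec(α, A)`: all limits of `θ_α^s(x, d_k)` with `x ∈ A` and positive
radii `d_k → 0`. -/
def Spec {X : Type*} [PseudoMetricSpace X] (α : Set X → ℝ≥0∞) (s : ℝ) (A : Set X) : Set ℝ≥0∞ :=
  {L | ∃ x ∈ A, ∃ d : ℕ → ℝ, (∀ k, 0 < d k) ∧ Tendsto d atTop (𝓝 0) ∧
    Tendsto (fun k => density α s x (d k)) atTop (𝓝 L)}

/-- `Im(θ_α^s, B)`: the densities of the typical balls. -/
def typicalDensities {n m : ℕ}
    (f : Fin m → EuclideanSpace ℝ (Fin n) → EuclideanSpace ℝ (Fin n))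
    (E : Set (EuclideanSpace ℝ (Fin n))) (α : Set (EuclideanSpace ℝ (Fin n)) → ℝ≥0∞) (s : ℝ) :
    Set ℝ≥0∞ :=
  {t | ∃ x d, IsTypicalBall f E x d ∧ t = density α s x d}

end SelfSimilarSpectrum

/-! A similitude `f_w` maps a typical ball onto a ball of the same density, and almost every point
of `E ∩ O` is approached along copies of every typical ball. Hence all such points `y` share one
spectrum `[a, b]`, which is the closure of the set of densities of typical balls. As every typical
ball has density in `[a, b]`, comparing a covering or a packing by typical balls with `μ`
gives `C^s ⌊E = b⁻¹ μ` and `P^s ⌊E = a⁻¹ μ`. The measures `H^s ⌊E` and `H_Sph^s ⌊E` are finite,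
nonzero and scale like `μ` under the `f_i`, so they are multiples of `μ` too, and `α` only
contributes the constant `α(E)`. -/

namespace SelfSimilarSpectrum

section Spectrum

variable {X : Type*} [PseudoMetricSpace X] {α : Set X → ℝ≥0∞} {s : ℝ}

lemma ofReal_two_mul_rpow_ne_zero {d : ℝ} (hd : 0 < d) : ENNReal.ofReal (2 * d) ^ s ≠ 0 :=
  (ENNReal.rpow_pos (ENNReal.ofReal_pos.2 (by positivity)) ENNReal.ofReal_ne_top).ne'

lemma ofReal_two_mul_rpow_ne_top {d : ℝ} (hd : 0 < d) : ENNReal.ofReal (2 * d) ^ s ≠ ∞ :=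
  ENNReal.rpow_ne_top_of_ne_zero (ENNReal.ofReal_pos.2 (by positivity)).ne' ENNReal.ofReal_ne_top

lemma le_density_iff {x : X} {d : ℝ} (hd : 0 < d) {c : ℝ≥0∞} :
    c ≤ density α s x d ↔ c * ENNReal.ofReal (2 * d) ^ s ≤ α (Metric.closedBall x d) :=
  ENNReal.le_div_iff_mul_le (Or.inl (ofReal_two_mul_rpow_ne_zero hd))
    (Or.inl (ofReal_two_mul_rpow_ne_top hd))

lemma density_le_iff {x : X} {d : ℝ} (hd : 0 < d) {c : ℝ≥0∞} :
    density α s x d ≤ c ↔ α (Metric.closedBall x d) ≤ c * ENNReal.ofReal (2 * d) ^ s :=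
  ENNReal.div_le_iff (ofReal_two_mul_rpow_ne_zero hd) (ofReal_two_mul_rpow_ne_top hd)

lemma mem_Spec_singleton_iff {x : X} {L : ℝ≥0∞} :
    L ∈ Spec α s {x} ↔ MapClusterPt L (𝓝[>] 0) (density α s x) := by
  constructor
  · rintro ⟨x, rfl, d, hd, hd₀, hL⟩
    exact hL.mapClusterPt.of_comp (tendsto_nhdsWithin_iff.2 ⟨hd₀, Eventually.of_forall hd⟩)
  · intro h
    have : (comap (density α s x) (𝓝 L) ⊓ 𝓝[>] 0).NeBot := by
      rw [inf_comm]
      exact (mapClusterPt_iff_ultrafilter.1 h).elim fun U hU =>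
        U.neBot.mono (le_inf hU.1 (tendsto_iff_comap.1 hU.2))
    obtain ⟨d, hd⟩ := exists_seq_tendsto (comap (density α s x) (𝓝 L) ⊓ 𝓝[>] 0)
    rw [tendsto_inf, tendsto_comap_iff, tendsto_nhdsWithin_iff] at hd
    obtain ⟨N, hN⟩ := eventually_atTop.1 hd.2.2
    exact ⟨x, rfl, fun k => d (k + N), fun k => hN _ (Nat.le_add_left _ _),
      (tendsto_add_atTop_iff_nat N).2 hd.2.1, (tendsto_add_atTop_iff_nat N).2 hd.1⟩

lemma mem_Spec_singleton_of_frequently {x : X} {L : ℝ≥0∞}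
    (h : ∃ᶠ d in 𝓝[>] 0, density α s x d = L) : L ∈ Spec α s {x} :=
  mem_Spec_singleton_iff.2 <| mapClusterPt_iff_frequently.2 fun _ hU =>
    h.mono fun _ hd => hd ▸ mem_of_mem_nhds hU

lemma isClosed_Spec_singleton (x : X) : IsClosed (Spec α s {x}) := by
  have : Spec α s {x} = {L | MapClusterPt L (𝓝[>] 0) (density α s x)} :=
    ext fun _ => mem_Spec_singleton_iff
  exact this ▸ isClosed_setOfPred_clusterPt

lemma Spec_mono {A B : Set X} (h : A ⊆ B) : Spec α s A ⊆ Spec α s B :=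
  fun _ ⟨x, hx, hL⟩ => ⟨x, h hx, hL⟩

lemma Spec_eq_biUnion (A : Set X) : Spec α s A = ⋃ x ∈ A, Spec α s {x} := by
  ext L
  simp only [Spec, mem_ofPred_eq, mem_iUnion₂, mem_singleton_iff, exists_eq_left, exists_prop]

lemma tendsto_mul_rpow {c : ℝ} (hc : 0 < c) (L : ℝ≥0∞) :
    Tendsto (fun d => L * ENNReal.ofReal (2 * d) ^ s) (𝓝 c)
      (𝓝 (L * ENNReal.ofReal (2 * c) ^ s)) := by
  refine ENNReal.Tendsto.const_mul ?_ (Or.inl (ofReal_two_mul_rpow_ne_zero hc))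
  exact (ENNReal.continuous_rpow_const.comp
    (ENNReal.continuous_ofReal.comp (continuous_const.mul continuous_id))).tendsto c

variable {x : X} {c : ℝ} {L : ℝ≥0∞}

lemma le_density_of_frequently_nhdsLE (hα : Monotone fun d => α (Metric.closedBall x d))
    (hc : 0 < c) (h : ∃ᶠ d in 𝓝[≤] c, L ≤ density α s x d) : L ≤ density α s x c := by
  rw [le_density_iff hc]
  have hpos : ∀ᶠ d in 𝓝[≤] c, 0 < d ∧ d ≤ c :=
    (eventually_nhdsWithin_of_eventually_nhds (lt_mem_nhds hc)).and self_mem_nhdsWithin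
  refine le_of_tendsto_of_frequently ((tendsto_mul_rpow hc L).mono_left nhdsWithin_le_nhds)
    ((h.and_eventually hpos).mono fun d hd => ?_)
  exact ((le_density_iff hd.2.1).1 hd.1).trans (hα hd.2.2)

lemma density_le_of_frequently_nhdsGT (hα : Monotone fun d => α (Metric.closedBall x d))
    (hc : 0 < c) (h : ∃ᶠ d in 𝓝[>] c, density α s x d ≤ L) : density α s x c ≤ L := by
  rw [density_le_iff hc]
  refine ge_of_tendsto_of_frequently ((tendsto_mul_rpow hc L).mono_left nhdsWithin_le_nhds)
    ((h.and_eventually self_mem_nhdsWithin).mono fun d hd => ?_)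
  exact (hα (le_of_lt hd.2)).trans ((density_le_iff (hc.trans hd.2)).1 hd.1)

-- The density may jump upwards in `d`, but a value that it crosses downwards is attained.
lemma exists_density_eq (hα : Monotone fun d => α (Metric.closedBall x d)) {a b : ℝ} (ha : 0 < a)
    (hab : a ≤ b) (hLa : L < density α s x a) (hLb : density α s x b < L) :
    ∃ c ∈ Icc a b, density α s x c = L := by
  set S := {d ∈ Icc a b | L ≤ density α s x d}
  have haS : a ∈ S := ⟨left_mem_Icc.2 hab, hLa.le⟩
  have hlub : IsLUB S (sSup S) := isLUB_csSup ⟨a, haS⟩ ⟨b, fun d hd => hd.1.2⟩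
  set c := sSup S
  have hac : a ≤ c := hlub.1 haS
  have hcb : c ≤ b := hlub.2 fun d hd => hd.1.2
  have hge : L ≤ density α s x c :=
    le_density_of_frequently_nhdsLE hα (ha.trans_le hac)
      ((hlub.frequently_mem ⟨a, haS⟩).mono fun d hd => hd.2)
  refine ⟨c, ⟨hac, hcb⟩, le_antisymm ?_ hge⟩
  have hlt : c < b := hcb.lt_of_ne fun h => (hLb.trans_le (h ▸ hge)).false
  have hev : ∀ᶠ d in 𝓝[>] c, density α s x d ≤ L := by
    filter_upwards [Ioo_mem_nhdsGT hlt] with d hd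
    by_contra! h
    exact (hlub.1 (show d ∈ S from ⟨⟨hac.trans hd.1.le, hd.2.le⟩, h.le⟩)).not_gt hd.1
  exact density_le_of_frequently_nhdsGT hα (ha.trans_le hac) hev.frequently

lemma frequently_density_eq (hα : Monotone fun d => α (Metric.closedBall x d))
    (hL : L ∈ Ioo (lowerDensity α s x) (upperDensity α s x)) :
    ∃ᶠ d in 𝓝[>] 0, density α s x d = L := by
  rw [(nhdsGT_basis (0 : ℝ)).frequently_iff]
  intro δ hδ
  obtain ⟨b, hb, hbL⟩ := ((nhdsGT_basis (0 : ℝ)).frequently_iff.1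
    (frequently_lt_of_liminf_lt (by isBoundedDefault) hL.1)) δ hδ
  obtain ⟨a, ha, haL⟩ := ((nhdsGT_basis (0 : ℝ)).frequently_iff.1
    (frequently_lt_of_lt_limsup (by isBoundedDefault) hL.2)) b hb.1
  obtain ⟨c, hc, h⟩ := exists_density_eq hα ha.1 ha.2.le haL hbL
  exact ⟨c, ⟨ha.1.trans_le hc.1, hc.2.trans_lt hb.2⟩, h⟩

lemma Spec_singleton_subset_Icc (x : X) :
    Spec α s {x} ⊆ Icc (lowerDensity α s x) (upperDensity α s x) := by
  rintro L ⟨x, rfl, d, hd, hd₀, hL⟩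
  have hd' : Tendsto d atTop (𝓝[>] 0) := tendsto_nhdsWithin_iff.2 ⟨hd₀, Eventually.of_forall hd⟩
  constructor
  · rw [← hL.liminf_eq]
    exact liminf_le_liminf_of_le (u := density α s x) hd'
  · rw [← hL.limsup_eq]
    exact limsup_le_limsup_of_le (u := density α s x) hd'

lemma lowerDensity_le_upperDensity (x : X) : lowerDensity α s x ≤ upperDensity α s x :=
  liminf_le_limsup

theorem Spec_singleton_eq_Icc (hα : Monotone fun d => α (Metric.closedBall x d)) :
    Spec α s {x} = Icc (lowerDensity α s x) (upperDensity α s x) := by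
  refine (Spec_singleton_subset_Icc x).antisymm ?_
  rcases (lowerDensity_le_upperDensity (α := α) (s := s) x).eq_or_lt with h | h
  · rw [h, Icc_self, singleton_subset_iff, mem_Spec_singleton_iff]
    exact (tendsto_of_liminf_eq_limsup h rfl).mapClusterPt
  · rw [← closure_Ioo h.ne]
    exact (isClosed_Spec_singleton x).closure_subset_iff.2 fun L hL =>
      mem_Spec_singleton_of_frequently (frequently_density_eq hα hL)

end Spectrum

section Premeasures

variable {X : Type*} {s δ : ℝ}

lemma isBallFamily_image {t : Set X} {ρ : X → ℝ} (ht : t.Countable)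
    (hρ : ∀ x ∈ t, ρ x ∈ Ioc 0 (δ / 2)) : IsBallFamily δ ((fun x => (x, ρ x)) '' t) := by
  refine ⟨ht.image _, ?_⟩
  rintro _ ⟨x, hx, rfl⟩
  exact ⟨(hρ x hx).1, by linarith [(hρ x hx).2]⟩

lemma ballSum_image (t : Set X) (ρ : X → ℝ) :
    ballSum s ((fun x => (x, ρ x)) '' t) = ∑' x : t, ENNReal.ofReal (2 * ρ x) ^ s :=
  tsum_image (fun p : X × ℝ => ENNReal.ofReal (2 * p.2) ^ s) fun _ _ _ _ h => congrArg Prod.fst h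

lemma ballSum_union_le (T U : Set (X × ℝ)) : ballSum s (T ∪ U) ≤ ballSum s T + ballSum s U :=
  ENNReal.tsum_union_le (fun p : X × ℝ => ENNReal.ofReal (2 * p.2) ^ s) T U

lemma IsBallFamily.union {T U : Set (X × ℝ)} (hT : IsBallFamily δ T) (hU : IsBallFamily δ U) :
    IsBallFamily δ (T ∪ U) :=
  ⟨hT.1.union hU.1, fun p hp => hp.elim (hT.2 p) (hU.2 p)⟩

lemma eventually_forall_ballFamily {F : Set X} {p : X → ℝ → Prop}
    (h : ∀ᶠ d in 𝓝[>] 0, ∀ x ∈ F, p x d) :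
    ∀ᶠ δ in 𝓝[>] (0 : ℝ), ∀ T : Set (X × ℝ), IsBallFamily δ T → (∀ q ∈ T, q.1 ∈ F) →
      ∀ q ∈ T, p q.1 q.2 := by
  obtain ⟨δ₀, hδ₀, h⟩ := mem_nhdsGT_iff_exists_Ioc_subset.1 h
  filter_upwards [Ioc_mem_nhdsGT hδ₀] with δ hδ T hT hTF q hq
  exact h ⟨(hT.2 q hq).1, by linarith [hδ.2, hT.2 q hq]⟩ q.1 (hTF q hq)

variable [PseudoMetricSpace X]

lemma Covers.union {T U : Set (X × ℝ)} {A B : Set X} (hT : Covers T A) (hU : Covers U B) :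
    Covers (T ∪ U) (A ∪ B) := by
  rw [Covers, biUnion_union]
  exact union_subset_union hT hU

lemma centredPre_union_le (A B : Set X) :
    centredPre s (A ∪ B) ≤ centredPre s A + centredPre s B := by
  refine iSup₂_le fun δ hδ => le_trans ?_ (add_le_add (le_iSup₂ δ hδ) (le_iSup₂ δ hδ))
  refine ENNReal.le_iInf₂_add_iInf₂ fun T hT U hU => ?_
  refine (iInf₂_le (T ∪ U) ⟨hT.1.union hU.1, ?_, hT.2.2.union hU.2.2⟩).trans (ballSum_union_le T U)
  exact fun p hp => hp.imp (hT.2.1 p) (hU.2.1 p)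

lemma packingPre_empty : packingPre s (∅ : Set X) = 0 := by
  refine nonpos_iff_eq_zero.1 ((iInf₂_le 1 one_pos).trans (iSup₂_le fun T hT => ?_))
  obtain rfl : T = ∅ := eq_empty_of_forall_notMem fun p hp => hT.2.1 p hp
  simp only [ballSum, tsum_empty, le_refl]

lemma packingMeasure_le_tsum {ι : Type*} [Countable ι] {A : Set X} {F : ι → Set X}
    (hF : ∀ i, IsClosed (F i)) (hA : A ⊆ ⋃ i, F i) :
    packingMeasure s A ≤ ∑' i, packingPre s (F i) := by
  have := Encodable.ofCountable ι
  rw [← tsum_iUnion_decode₂ (packingPre s) packingPre_empty F]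
  refine iInf₂_le (fun k => ⋃ i ∈ Encodable.decode₂ ι k, F i) ⟨fun k => ?_, ?_⟩
  · exact Encodable.iUnion_decode₂_cases (C := IsClosed) isClosed_empty hF
  · rwa [Encodable.iUnion_decode₂]

lemma packingMeasure_le_add {A F : Set X} (hF : IsClosed F) :
    packingMeasure s A ≤ packingPre s F + packingMeasure s (A \ F) := by
  simp only [packingMeasure, ENNReal.add_iInf₂]
  refine le_iInf₂ fun G hG => ?_
  let F' : ℕ → Set X := fun k => Nat.casesOn k F G
  suffices h : (∀ k, IsClosed (F' k)) ∧ A ⊆ ⋃ k, F' k from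
    (iInf₂_le F' h).trans_eq (tsum_eq_zero_add' ENNReal.summable)
  refine ⟨?_, fun x hx => ?_⟩
  · rintro (_ | k)
    exacts [hF, hG.1 k]
  · by_cases hxF : x ∈ F
    · exact mem_iUnion.2 ⟨0, hxF⟩
    · obtain ⟨k, hk⟩ := mem_iUnion.1 (hG.2 ⟨hx, hxF⟩)
      exact mem_iUnion.2 ⟨k + 1, hk⟩

lemma eventually_closedBall_subset {K O : Set X} (hK : IsCompact K) (hO : IsOpen O) (hKO : K ⊆ O) :
    ∀ᶠ d in 𝓝[>] 0, ∀ x ∈ K, Metric.closedBall x d ⊆ O := by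
  obtain ⟨δ, hδ, h⟩ := hK.exists_cthickening_subset_open hO hKO
  filter_upwards [Ioc_mem_nhdsGT hδ] with d hd x hx
  exact (Metric.closedBall_subset_cthickening hx d).trans ((Metric.cthickening_mono hd.2 K).trans h)

end Premeasures

section DensityTheorems

variable {X : Type*} [PseudoMetricSpace X] [MeasurableSpace X] {μ : Measure X} {s : ℝ}
  {A F O : Set X} {c : ℝ≥0∞}

theorem measure_div_le_centredPre (h : ∀ᶠ d in 𝓝[>] 0, ∀ x ∈ F, density μ s x d ≤ c) :
    μ F / c ≤ centredPre s F := by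
  obtain ⟨δ, hT', hδ⟩ := ((eventually_forall_ballFamily h).and self_mem_nhdsWithin).exists
  refine le_iSup₂_of_le δ hδ (le_iInf₂ fun T hT => ?_)
  refine ENNReal.div_le_of_le_mul' ?_
  calc μ F ≤ μ (⋃ p ∈ T, Metric.closedBall p.1 p.2) := measure_mono hT.2.2
    _ ≤ ∑' p : T, μ (Metric.closedBall p.1.1 p.1.2) := measure_biUnion_le μ hT.1.1 _
    _ ≤ ∑' p : T, c * ENNReal.ofReal (2 * p.1.2) ^ s := ENNReal.tsum_le_tsum fun p =>
        (density_le_iff (hT.1.2 p p.2).1).1 (hT' T hT.1 hT.2.1 p p.2)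
    _ = c * ballSum s T := ENNReal.tsum_mul_left

theorem mul_packingPre_le [OpensMeasurableSpace X] [IsFiniteMeasure μ] (hFc : IsClosed F)
    (h : ∀ᶠ d in 𝓝[>] 0, ∀ x ∈ F, c ≤ density μ s x d) : c * packingPre s F ≤ μ F := by
  have hlim := (tendsto_measure_cthickening_of_isClosed (μ := μ) ⟨1, one_pos, measure_ne_top _ _⟩
    hFc).mono_left (nhdsWithin_le_nhds (s := Ioi 0))
  refine ge_of_tendsto hlim ?_
  filter_upwards [eventually_forall_ballFamily h, self_mem_nhdsWithin] with δ hT' hδ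
  refine (mul_le_mul_right (iInf₂_le δ hδ) c).trans ?_
  simp only [ENNReal.mul_iSup]
  refine iSup₂_le fun T hT => ?_
  calc c * ballSum s T = ∑' p : T, c * ENNReal.ofReal (2 * p.1.2) ^ s :=
        ENNReal.tsum_mul_left.symm
    _ ≤ ∑' p : T, μ (Metric.closedBall p.1.1 p.1.2) := ENNReal.tsum_le_tsum fun p =>
        (le_density_iff (hT.1.2 p p.2).1).1 (hT' T hT.1 hT.2.1 p p.2)
    _ = μ (⋃ p ∈ T, Metric.closedBall p.1 p.2) :=
        (measure_biUnion hT.1.1 hT.2.2 fun p _ => Metric.isClosed_closedBall.measurableSet).symm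
    _ ≤ μ (Metric.cthickening δ F) := measure_mono <| iUnion₂_subset fun p hp =>
        (Metric.closedBall_subset_cthickening (hT.2.1 p hp) _).trans
          (Metric.cthickening_mono (by linarith [hT.1.2 p hp]) _)

theorem measure_div_le_centredHausdorff [OpensMeasurableSpace X] [μ.InnerRegularCompactLTTop]
    [IsFiniteMeasure μ] [T2Space X] (hA : MeasurableSet A) (hO : IsOpen O) (hAO : μ (A \ O) = 0)
    (h : ∀ x ∈ A, ∀ d > 0, Metric.closedBall x d ⊆ O → density μ s x d ≤ c) :
    μ A / c ≤ centredHausdorff s A := by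
  have hμ : μ A = μ (A ∩ O) := by
    rw [← measure_inter_add_sdiff A hO.measurableSet, hAO, add_zero]
  rw [hμ, (hA.inter hO.measurableSet).measure_eq_iSup_isCompact_of_ne_top (measure_ne_top μ _)]
  simp only [ENNReal.iSup_div]
  refine iSup₂_le fun K hKA => iSup_le fun hK => ?_
  refine le_iSup₂_of_le K ⟨hKA.trans inter_subset_left, hK.isClosed⟩
    (measure_div_le_centredPre ?_)
  filter_upwards [eventually_closedBall_subset hK hO (hKA.trans inter_subset_right),
    self_mem_nhdsWithin] with d hd hd₀ x hx
  exact h x (hKA hx).1 d hd₀ (hd x hx)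

end DensityTheorems

section Besicovitch

variable {X : Type*} [MetricSpace X] [SecondCountableTopology X] [HasBesicovitchCovering X]
  [MeasurableSpace X] [BorelSpace X] {μ : Measure X} [IsFiniteMeasure μ] {s : ℝ}
  {A E F G O : Set X} {a c c₀ : ℝ≥0∞}

lemma frequently_nhdsGT_zero_iff {p : ℝ → Prop} :
    (∃ᶠ d in 𝓝[>] 0, p d) ↔ ∀ δ > 0, ({d | p d} ∩ Ioo 0 δ).Nonempty := by
  rw [(nhdsGT_basis (0 : ℝ)).frequently_iff]
  exact forall₂_congr fun δ _ => exists_congr fun d => and_comm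

lemma exists_centred_cover (h : ∀ x ∈ F, ∃ᶠ d in 𝓝[>] 0, c ≤ density μ s x d) {δ : ℝ} (hδ : 0 < δ)
    {ε : ℝ≥0∞} (hε : ε ≠ 0) :
    ∃ T : Set (X × ℝ), IsBallFamily δ T ∧ (∀ p ∈ T, p.1 ∈ F) ∧ Covers T F ∧
      c * ballSum s T ≤ μ F + ε := by
  obtain ⟨t, ρ, htc, htF, hρ, hcov, hsum⟩ := Besicovitch.exists_closedBall_covering_tsum_measure_le
    μ hε (fun x => {d | c ≤ density μ s x d ∧ d ∈ Ioo 0 (δ / 2)}) F fun x hx =>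
      frequently_nhdsGT_zero_iff.1 ((h x hx).and_eventually (Ioo_mem_nhdsGT (half_pos hδ)))
  refine ⟨(fun x => (x, ρ x)) '' t, isBallFamily_image htc fun x hx =>
    Ioo_subset_Ioc_self (hρ x hx).2, forall_mem_image.2 htF, by rwa [Covers, biUnion_image], ?_⟩
  calc c * ballSum s ((fun x => (x, ρ x)) '' t)
      = ∑' x : t, c * ENNReal.ofReal (2 * ρ x) ^ s := by
        rw [ballSum_image, ENNReal.tsum_mul_left]
    _ ≤ ∑' x : t, μ (Metric.closedBall x.1 (ρ x)) := ENNReal.tsum_le_tsum fun x =>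
        (le_density_iff (hρ x x.2).2.1).1 (hρ x x.2).1
    _ ≤ μ F + ε := hsum

theorem mul_centredPre_le (h : ∀ x ∈ F, ∃ᶠ d in 𝓝[>] 0, c ≤ density μ s x d) :
    c * centredPre s F ≤ μ F := by
  simp only [centredPre, ENNReal.mul_iSup]
  refine iSup₂_le fun δ hδ => ENNReal.le_of_forall_pos_le_add fun ε hε _ => ?_
  obtain ⟨T, hT, hTF, hTc, hsum⟩ := exists_centred_cover h hδ (ENNReal.coe_pos.2 hε).ne'
  exact (mul_le_mul_right (iInf₂_le T ⟨hT, hTF, hTc⟩) c).trans hsum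

theorem mul_centredHausdorff_le (hc₀ : c₀ ≠ 0) (h₀ : ∀ x ∈ A, c₀ ≤ upperDensity μ s x)
    (h : ∀ᵐ x ∂μ, x ∈ A → c ≤ upperDensity μ s x) : c * centredHausdorff s A ≤ μ A := by
  simp only [centredHausdorff, ENNReal.mul_iSup]
  refine iSup₂_le fun F hF => ?_
  refine ENNReal.mul_le_of_forall_lt fun c' hc' m hm => ?_
  refine (mul_le_mul_right hm.le c').trans ?_
  have frequently_le {b : ℝ≥0∞} {x : X} (hb : b < upperDensity μ s x) :
      ∃ᶠ d in 𝓝[>] 0, b ≤ density μ s x d :=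
    (frequently_lt_of_lt_limsup (by isBoundedDefault) hb).mono fun _ hd => hd.le
  set G := {x ∈ F | c' < upperDensity μ s x}
  have hnull : μ (F \ G) = 0 := measure_mono_null
    (fun x hx (hxA : x ∈ A → c ≤ _) => hx.2 ⟨hx.1, hc'.trans_le (hxA (hF.1 hx.1))⟩)
    (mem_ae_iff.1 h)
  have hrest : centredPre s (F \ G) = 0 := by
    obtain ⟨b, hb₀, hb⟩ := exists_between (pos_iff_ne_zero.2 hc₀)
    have := mul_centredPre_le (μ := μ) (s := s) fun x (hx : x ∈ F \ G) =>
      frequently_le (hb.trans_le (h₀ x (hF.1 hx.1)))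
    rw [hnull, nonpos_iff_eq_zero, mul_eq_zero] at this
    exact this.resolve_left hb₀.ne'
  calc c' * centredPre s F = c' * centredPre s (G ∪ F \ G) := by
        rw [union_sdiff_cancel (sep_subset _ _)]
    _ ≤ c' * centredPre s G := by
        simpa only [hrest, add_zero] using
          mul_le_mul_right (centredPre_union_le (s := s) G (F \ G)) c'
    _ ≤ μ G := mul_centredPre_le fun x hx => frequently_le hx.2
    _ ≤ μ A := measure_mono ((sep_subset _ _).trans hF.1)

theorem measure_div_le_packingPre (hGF : G ⊆ F)
    (h : ∀ x ∈ G, ∃ᶠ d in 𝓝[>] 0, density μ s x d ≤ c) : μ G / c ≤ packingPre s F := by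
  refine le_iInf₂ fun δ hδ => ?_
  obtain ⟨t, ρ, htc, htG, hρ, hcov, hdis⟩ := Besicovitch.exists_disjoint_closedBall_covering_ae
    μ (fun x => {d | density μ s x d ≤ c}) G
    (fun x hx => frequently_nhdsGT_zero_iff.1 (h x hx)) (fun _ => δ / 2) fun _ _ => half_pos hδ
  refine le_iSup₂_of_le ((fun x => (x, ρ x)) '' t) ⟨isBallFamily_image htc fun x hx =>
    Ioo_subset_Ioc_self (hρ x hx).2, forall_mem_image.2 fun x hx => hGF (htG hx), ?_⟩ ?_
  · rintro _ ⟨x, hx, rfl⟩ _ ⟨y, hy, rfl⟩ hxy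
    exact hdis hx hy fun h => hxy (by rw [h])
  · refine ENNReal.div_le_of_le_mul' ?_
    calc μ G ≤ μ (⋃ x ∈ t, Metric.closedBall x (ρ x)) := measure_mono_ae (ae_le_set.2 hcov)
      _ ≤ ∑' x : t, μ (Metric.closedBall x.1 (ρ x)) := measure_biUnion_le μ htc _
      _ ≤ ∑' x : t, c * ENNReal.ofReal (2 * ρ x) ^ s := ENNReal.tsum_le_tsum fun x =>
          (density_le_iff (hρ x x.2).2.1).1 (hρ x x.2).1
      _ = c * ballSum s ((fun x => (x, ρ x)) '' t) := by
          rw [ballSum_image, ENNReal.tsum_mul_left]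

theorem measure_div_le_packingMeasure (h : ∀ᵐ x ∂μ, x ∈ A → lowerDensity μ s x ≤ a) :
    μ A / a ≤ packingMeasure s A := by
  rcases eq_or_ne a ∞ with rfl | ha
  · simp only [ENNReal.div_top, zero_le]
  have := nhdsGT_neBot_of_exists_gt ⟨∞, ha.lt_top⟩
  have hlim : Tendsto (fun a' => μ A / a') (𝓝[>] a) (𝓝 (μ A / a)) :=
    ENNReal.Tendsto.const_div nhdsWithin_le_nhds (Or.inr (measure_ne_top μ A))
  refine le_of_tendsto hlim (eventually_nhdsWithin_of_forall fun a' ha' => ?_)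
  set G := {x | lowerDensity μ s x ≤ a}
  refine le_iInf₂ fun F hF => ?_
  have hAG : μ A ≤ ∑' k, μ (F k ∩ G) :=
    (measure_mono_ae (t := ⋃ k, F k ∩ G) (by
      filter_upwards [h] with x hx hxA
      rw [← iUnion_inter]
      exact ⟨hF.2 hxA, hx hxA⟩)).trans (measure_iUnion_le _)
  calc μ A / a' ≤ (∑' k, μ (F k ∩ G)) / a' := ENNReal.div_le_div_right hAG _
    _ = ∑' k, μ (F k ∩ G) / a' := by simp only [div_eq_mul_inv, ENNReal.tsum_mul_right]
    _ ≤ ∑' k, packingPre s (F k) := ENNReal.tsum_le_tsum fun k =>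
        measure_div_le_packingPre inter_subset_left fun x hx =>
          (frequently_lt_of_liminf_lt (by isBoundedDefault) (hx.2.trans_lt ha')).mono
            fun _ hd => hd.le

lemma mul_packingMeasure_le_of_uniform (hE : IsClosed E) (hAE : A ⊆ E)
    (h : ∀ᶠ d in 𝓝[>] 0, ∀ x ∈ E, c ≤ density μ s x d) : c * packingMeasure s A ≤ μ A := by
  refine ENNReal.le_of_forall_pos_le_add fun ε hε _ => ?_
  obtain ⟨t, ρ, htc, -, -, hcov, hsum⟩ := Besicovitch.exists_closedBall_covering_tsum_measure_le
    μ (ENNReal.coe_pos.2 hε).ne' (fun _ => univ) A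
    fun _ _ δ hδ => ⟨δ / 2, mem_univ _, half_pos hδ, half_lt_self hδ⟩
  have := htc.to_subtype
  have hAt : A ⊆ ⋃ x : t, Metric.closedBall x.1 (ρ x) ∩ E := fun x hx => by
    rw [← iUnion_inter, iUnion_subtype (· ∈ t) fun x => Metric.closedBall x.1 (ρ x)]
    exact ⟨hcov hx, hAE hx⟩
  calc c * packingMeasure s A
      ≤ c * ∑' x : t, packingPre s (Metric.closedBall x.1 (ρ x) ∩ E) := mul_le_mul_right
        (packingMeasure_le_tsum (fun _ => Metric.isClosed_closedBall.inter hE) hAt) c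
    _ = ∑' x : t, c * packingPre s (Metric.closedBall x.1 (ρ x) ∩ E) :=
        ENNReal.tsum_mul_left.symm
    _ ≤ ∑' x : t, μ (Metric.closedBall x.1 (ρ x)) := ENNReal.tsum_le_tsum fun x =>
        (mul_packingPre_le (Metric.isClosed_closedBall.inter hE)
          (h.mono fun d hd y hy => hd y hy.2)).trans (measure_mono inter_subset_left)
    _ ≤ μ A + ε := hsum

-- The compact part of `A` inside `O` is treated with the sharp constant `a`; the uniform bound `c`
-- controls the packing measure of the small remainder.
lemma mul_packingMeasure_le_add [μ.InnerRegularCompactLTTop] (hE : IsClosed E) (hAE : A ⊆ E)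
    (hc : c ≠ 0) (hunif : ∀ᶠ d in 𝓝[>] 0, ∀ x ∈ E, c ≤ density μ s x d) (hA : MeasurableSet A)
    (hO : IsOpen O) (hAO : μ (A \ O) = 0)
    (h : ∀ x ∈ A, ∀ d > 0, Metric.closedBall x d ⊆ O → a ≤ density μ s x d)
    {ε : ℝ≥0∞} (hε : ε ≠ 0) (hε' : ε ≠ ∞) :
    a * packingMeasure s A ≤ μ A + a * (ε / c) := by
  obtain ⟨K, hKA, hK, hKε⟩ := (hA.inter hO.measurableSet).exists_isCompact_sdiff_lt
    (measure_ne_top μ _) hε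
  have hKA' : K ⊆ A := hKA.trans inter_subset_left
  have hsmall : μ (A \ K) ≤ ε :=
    (measure_mono_ae (ae_le_set.2 (measure_mono_null (by grind) hAO))).trans hKε.le
  have hrest : packingMeasure s (A \ K) ≤ ε / c := by
    rw [ENNReal.le_div_iff_mul_le (Or.inl hc) (Or.inr hε'), mul_comm]
    exact (mul_packingMeasure_le_of_uniform hE (sdiff_subset.trans hAE) hunif).trans hsmall
  have hcomp : a * packingPre s K ≤ μ A :=
    (mul_packingPre_le hK.isClosed (by
      filter_upwards [eventually_closedBall_subset hK hO (hKA.trans inter_subset_right),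
        self_mem_nhdsWithin] with d hd hd₀ x hx using h x (hKA' hx) d hd₀ (hd x hx))).trans
      (measure_mono hKA')
  calc a * packingMeasure s A
      ≤ a * packingPre s K + a * packingMeasure s (A \ K) := by
        rw [← mul_add]
        exact mul_le_mul_right (packingMeasure_le_add hK.isClosed) a
    _ ≤ μ A + a * (ε / c) := add_le_add hcomp (mul_le_mul_right hrest a)

theorem mul_packingMeasure_le [μ.InnerRegularCompactLTTop] (hE : IsClosed E) (hAE : A ⊆ E)
    (hc : c ≠ 0) (hunif : ∀ᶠ d in 𝓝[>] 0, ∀ x ∈ E, c ≤ density μ s x d) (hA : MeasurableSet A)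
    (hO : IsOpen O) (hAO : μ (A \ O) = 0) (ha : a ≠ ∞)
    (h : ∀ x ∈ A, ∀ d > 0, Metric.closedBall x d ⊆ O → a ≤ density μ s x d) :
    a * packingMeasure s A ≤ μ A := by
  have hlim : Tendsto (fun ε : ℝ≥0∞ => μ A + a * (ε / c)) (𝓝[>] 0) (𝓝 (μ A)) := by
    have hε : Tendsto (fun ε : ℝ≥0∞ => a * (ε / c)) (𝓝[>] 0) (𝓝 (a * (0 / c))) :=
      ENNReal.Tendsto.const_mul (ENNReal.Tendsto.div_const nhdsWithin_le_nhds (Or.inr hc))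
        (Or.inr ha)
    simpa only [ENNReal.zero_div, mul_zero, add_zero] using hε.const_add (μ A)
  refine ge_of_tendsto hlim ?_
  filter_upwards [Ioo_mem_nhdsGT one_pos] with ε hε using
    mul_packingMeasure_le_add hE hAE hc hunif hA hO hAO h hε.1.ne' hε.2.ne_top

end Besicovitch

section Similitude

variable {X Y Z : Type*} [PseudoMetricSpace X] [PseudoMetricSpace Y] [PseudoMetricSpace Z]
  {t u : ℝ}

/-- `g` is a similitude of ratio `t > 0`. The maps `f i` of an `IsSimilitudeSystem` and their
compositions along words are the instances of interest. -/
structure IsSimilitude (t : ℝ) (g : X → Y) : Prop where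
  pos : 0 < t
  dist_eq : ∀ x y, dist (g x) (g y) = t * dist x y

namespace IsSimilitude

lemma id : IsSimilitude 1 (id : X → X) :=
  ⟨one_pos, fun _ _ => (one_mul _).symm⟩

lemma comp {h : Y → Z} {g : X → Y} (hh : IsSimilitude u h) (hg : IsSimilitude t g) :
    IsSimilitude (u * t) (h ∘ g) :=
  ⟨mul_pos hh.pos hg.pos, fun x y => by
    simp only [Function.comp_apply, hh.dist_eq, hg.dist_eq, mul_assoc]⟩

lemma lipschitzWith {g : X → Y} (hg : IsSimilitude t g) : LipschitzWith t.toNNReal g :=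
  LipschitzWith.of_dist_le_mul fun x y => by rw [hg.dist_eq, Real.coe_toNNReal _ hg.pos.le]

lemma continuous {g : X → Y} (hg : IsSimilitude t g) : Continuous g :=
  hg.lipschitzWith.continuous

lemma injective {X : Type*} [MetricSpace X] {g : X → Y} (hg : IsSimilitude t g) :
    Function.Injective g := fun x y h => by
  have hxy : t * dist x y = 0 := by rw [← hg.dist_eq, h, dist_self]
  exact dist_eq_zero.1 ((mul_eq_zero.1 hxy).resolve_left hg.pos.ne')

lemma preimage_closedBall {g : X → Y} (hg : IsSimilitude t g) (x : X) (d : ℝ) :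
    g ⁻¹' Metric.closedBall (g x) (t * d) = Metric.closedBall x d := by
  ext y
  rw [mem_preimage, Metric.mem_closedBall, Metric.mem_closedBall, hg.dist_eq,
    mul_le_mul_iff_right₀ hg.pos]

lemma image_closedBall {g : X → Y} (hg : IsSimilitude t g) (hs : Function.Surjective g) (x : X)
    (d : ℝ) : g '' Metric.closedBall x d = Metric.closedBall (g x) (t * d) := by
  rw [← hg.preimage_closedBall, image_preimage_eq _ hs]

/-- Rescaled to ratio `1`, a similitude is an isometry, hence affine, hence bijective by
dimension. -/
lemma surjective {V : Type*} [NormedAddCommGroup V] [NormedSpace ℝ V] [FiniteDimensional ℝ V]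
    [StrictConvexSpace ℝ V] {g : V → V} (hg : IsSimilitude t g) : Function.Surjective g := by
  have hiso : Isometry fun x => t⁻¹ • g x := Isometry.of_dist_eq fun x y => by
    rw [dist_smul₀, hg.dist_eq, Real.norm_eq_abs, abs_of_pos (inv_pos.2 hg.pos),
      inv_mul_cancel_left₀ hg.pos.ne']
  have hsurj : Function.Surjective hiso.affineIsometryOfStrictConvexSpace :=
    hiso.affineIsometryOfStrictConvexSpace.toAffineMap.linear_surjective_iff.1
      (hiso.affineIsometryOfStrictConvexSpace.linearIsometry.toLinearIsometryEquiv rfl).surjective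
  intro y
  obtain ⟨x, hx⟩ := hsurj (t⁻¹ • y)
  exact ⟨x, smul_right_injective _ (inv_pos.2 hg.pos).ne' (by simpa using hx)⟩

lemma measurableEmbedding {X : Type*} [MetricSpace X] [CompleteSpace X] [SecondCountableTopology X]
    [MeasurableSpace X] [BorelSpace X] [MeasurableSpace Y] [BorelSpace Y] [T2Space Y]
    [SecondCountableTopology Y] {g : X → Y} (hg : IsSimilitude t g) : MeasurableEmbedding g :=
  hg.continuous.measurableEmbedding hg.injective

end IsSimilitude

lemma mapsTo_cthickening_of_lipschitzWith {g : X → Y} {q : NNReal} (hg : LipschitzWith q g)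
    {A : Set X} {B : Set Y} (hgA : MapsTo g A B) (R : ℝ) :
    MapsTo g (Metric.cthickening R A) (Metric.cthickening (q * R) B) := fun x hx => by
  rcases A.eq_empty_or_nonempty with rfl | hA
  · simp only [Metric.cthickening_empty, mem_empty_iff_false] at hx
  have := hA.to_subtype
  rw [Metric.mem_cthickening_iff] at hx ⊢
  rw [ENNReal.ofReal_mul q.coe_nonneg, ENNReal.ofReal_coe_nnreal]
  refine le_trans ?_ (mul_le_mul_right hx q)
  rw [Metric.infEDist, Metric.infEDist, iInf_subtype' (p := (· ∈ A)),
    ENNReal.mul_iInf fun h => (ENNReal.coe_ne_top h).elim]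
  exact le_iInf fun y => (iInf₂_le (g y) (hgA y.2)).trans (hg x y)

end Similitude

section Words

variable {ι X M : Type*}

/-- The composition `f i₁ ∘ ⋯ ∘ f iₖ` of the maps along a word `[i₁, …, iₖ]`. -/
def wordMap (f : ι → X → X) (w : List ι) (x : X) : X :=
  w.foldr f x

/-- The product `r i₁ * ⋯ * r iₖ` along a word `[i₁, …, iₖ]`, used for contraction ratios as well
as for the weights of an invariant measure. -/
def wordProd [Monoid M] (r : ι → M) (w : List ι) : M :=
  (w.map r).prod

@[simp]
lemma wordMap_nil (f : ι → X → X) : wordMap f [] = id :=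
  rfl

@[simp]
lemma wordMap_cons (f : ι → X → X) (i : ι) (w : List ι) :
    wordMap f (i :: w) = f i ∘ wordMap f w :=
  rfl

lemma wordMap_append (f : ι → X → X) (v w : List ι) :
    wordMap f (v ++ w) = wordMap f v ∘ wordMap f w :=
  funext fun _ => List.foldr_append

lemma wordMap_concat (f : ι → X → X) (w : List ι) (i : ι) :
    wordMap f (w ++ [i]) = wordMap f w ∘ f i :=
  wordMap_append f w [i]

@[simp]
lemma wordProd_nil [Monoid M] (r : ι → M) : wordProd r [] = 1 :=
  rfl

@[simp]
lemma wordProd_cons [Monoid M] (r : ι → M) (i : ι) (w : List ι) :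
    wordProd r (i :: w) = r i * wordProd r w :=
  List.prod_cons

lemma wordProd_concat [Monoid M] (r : ι → M) (w : List ι) (i : ι) :
    wordProd r (w ++ [i]) = wordProd r w * r i := by
  simp only [wordProd, List.map_append, List.map_cons, List.map_nil, List.prod_append,
    List.prod_singleton]

lemma isSimilitude_wordMap [PseudoMetricSpace X] {f : ι → X → X} {r : ι → ℝ}
    (h : ∀ i, IsSimilitude (r i) (f i)) (w : List ι) :
    IsSimilitude (wordProd r w) (wordMap f w) := by
  induction w with
  | nil => exact IsSimilitude.id
  | cons i w ih => exact wordProd_cons r i w ▸ (h i).comp ih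

lemma mapsTo_wordMap {f : ι → X → X} {A : Set X} (h : ∀ i, MapsTo (f i) A A) (w : List ι) :
    MapsTo (wordMap f w) A A := by
  induction w with
  | nil => exact mapsTo_id A
  | cons i w ih => exact (h i).comp ih

lemma wordProd_ofReal_rpow {r : ι → ℝ} (hr : ∀ i, 0 < r i) (s : ℝ) (w : List ι) :
    wordProd (fun i => ENNReal.ofReal (r i ^ s)) w = ENNReal.ofReal (wordProd r w ^ s) := by
  induction w with
  | nil => simp only [wordProd_nil, Real.one_rpow, ENNReal.ofReal_one]
  | cons i w ih =>
    have hw : 0 ≤ wordProd r w := List.prod_nonneg fun _ ha => by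
      obtain ⟨j, -, rfl⟩ := List.mem_map.1 ha
      exact (hr j).le
    rw [wordProd_cons, wordProd_cons, ih, Real.mul_rpow (hr i).le hw,
      ENNReal.ofReal_mul (Real.rpow_nonneg (hr i).le _)]

end Words

section SelfSimilarSet

variable {n m : ℕ} {f : Fin m → EuclideanSpace ℝ (Fin n) → EuclideanSpace ℝ (Fin n)}
  {r : Fin m → ℝ} {E : Set (EuclideanSpace ℝ (Fin n))}

namespace IsSimilitudeSystem

lemma isSimilitude (hf : IsSimilitudeSystem f r) (i : Fin m) : IsSimilitude (r i) (f i) :=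
  ⟨(hf i).1, (hf i).2.2⟩

lemma isSimilitude_wordMap (hf : IsSimilitudeSystem f r) (w : List (Fin m)) :
    IsSimilitude (wordProd r w) (wordMap f w) :=
  SelfSimilarSpectrum.isSimilitude_wordMap hf.isSimilitude w

lemma exists_ratio_lowerBound (hf : IsSimilitudeSystem f r) :
    ∃ p, 0 < p ∧ p < 1 ∧ ∀ i, p ≤ r i := by
  rcases isEmpty_or_nonempty (Fin m) with h | h
  · exact ⟨1 / 2, by norm_num, by norm_num, h.elim⟩
  · obtain ⟨i, hi⟩ := Finite.exists_min r
    exact ⟨r i, (hf i).1, (hf i).2.1, hi⟩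

lemma exists_ratio_upperBound (hf : IsSimilitudeSystem f r) :
    ∃ q, 0 < q ∧ q < 1 ∧ ∀ i, r i ≤ q := by
  rcases isEmpty_or_nonempty (Fin m) with h | h
  · exact ⟨1 / 2, by norm_num, by norm_num, h.elim⟩
  · obtain ⟨i, hi⟩ := Finite.exists_max r
    exact ⟨r i, (hf i).1, (hf i).2.1, hi⟩

end IsSimilitudeSystem

namespace IsSelfSimilarSet

lemma mapsTo (hE : IsSelfSimilarSet f E) (i : Fin m) : MapsTo (f i) E E := fun x hx => by
  rw [hE.eq_iUnion]
  exact mem_iUnion.2 ⟨i, mem_image_of_mem _ hx⟩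

lemma exists_dist_le (hE : IsSelfSimilarSet f E) :
    ∃ D : ℝ, 1 ≤ D ∧ ∀ x ∈ E, ∀ y ∈ E, dist x y ≤ D :=
  ⟨max 1 (Metric.diam E), le_max_left _ _, fun _ hx _ hy =>
    (Metric.dist_le_diam_of_mem hE.isCompact.isBounded hx hy).trans (le_max_right _ _)⟩

lemma exists_word_wordProd_mem_Icc (hf : IsSimilitudeSystem f r) (hE : IsSelfSimilarSet f E)
    {p : ℝ} (hp : ∀ i, p ≤ r i) {x : EuclideanSpace ℝ (Fin n)} (hx : x ∈ E) {η : ℝ}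
    (hη : 0 < η) (hη1 : η ≤ 1) :
    ∃ w, x ∈ wordMap f w '' E ∧ wordProd r w ∈ Icc (p * η) η := by
  obtain ⟨q, hq0, hq1, hq⟩ := hf.exists_ratio_upperBound
  obtain ⟨k, hk⟩ := exists_pow_lt_of_lt_one hη hq1
  induction k generalizing x η with
  | zero => linarith [pow_zero q]
  | succ k ih =>
    obtain ⟨i, x', hx', rfl⟩ := mem_iUnion.1 (hE.eq_iUnion ▸ hx)
    have hr := (hf i).1
    rcases le_or_gt (r i) η with h | h
    · refine ⟨[i], mem_image_of_mem _ hx', ?_⟩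
      rw [wordProd_cons, wordProd_nil, mul_one]
      exact ⟨by nlinarith [hp i], h⟩
    · have hkη : q ^ k < η / r i := by
        rw [lt_div_iff₀ hr]
        refine lt_of_le_of_lt ?_ hk
        rw [pow_succ]
        exact mul_le_mul_of_nonneg_left (hq i) (pow_nonneg hq0.le _)
      obtain ⟨w, hw, hpw, hwη⟩ := ih hx' (div_pos hη hr) ((div_le_one hr).2 h.le) hkη
      refine ⟨i :: w, by rw [wordMap_cons, image_comp]; exact mem_image_of_mem _ hw, ?_⟩
      rw [wordProd_cons]
      rw [← mul_div_assoc, div_le_iff₀ hr] at hpw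
      rw [le_div_iff₀ hr] at hwη
      exact ⟨by linarith, by linarith⟩

lemma exists_word_subset_closedBall (hf : IsSimilitudeSystem f r) (hE : IsSelfSimilarSet f E)
    {x : EuclideanSpace ℝ (Fin n)} (hx : x ∈ E) {ε : ℝ} (hε : 0 < ε) :
    ∃ w, x ∈ wordMap f w '' E ∧ wordMap f w '' E ⊆ Metric.closedBall x ε := by
  obtain ⟨p, -, -, hp⟩ := hf.exists_ratio_lowerBound
  obtain ⟨D, hD1, hD⟩ := hE.exists_dist_le
  obtain ⟨w, hw, -, hwη⟩ := hE.exists_word_wordProd_mem_Icc hf hp hx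
    (η := min 1 (ε / D)) (by positivity) (min_le_left _ _)
  refine ⟨w, hw, ?_⟩
  obtain ⟨x', hx', rfl⟩ := hw
  rintro _ ⟨y, hy, rfl⟩
  have hwε : wordProd r w * D ≤ ε :=
    (le_div_iff₀ (one_pos.trans_le hD1)).1 (hwη.trans (min_le_right _ _))
  rw [Metric.mem_closedBall, (hf.isSimilitude_wordMap w).dist_eq]
  exact (mul_le_mul_of_nonneg_left (hD y hy x' hx') (hf.isSimilitude_wordMap w).pos.le).trans hwε

end IsSelfSimilarSet

end SelfSimilarSet

section InvariantMeasure

variable {ι X : Type*} [Fintype ι] [MeasurableSpace X]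

/-- `ν` is a finite nonzero compactly supported fixed point of the Hutchinson operator with
weights `c`. The total mass is left free, so that the multiples of the natural measure are
covered. -/
structure IsInvariantMeasure [TopologicalSpace X] (f : ι → X → X) (c : ι → ℝ≥0∞) (ν : Measure X) :
    Prop where
  isFiniteMeasure : IsFiniteMeasure ν
  ne_zero : ν ≠ 0
  compactly_supported : ∃ K, IsCompact K ∧ ν Kᶜ = 0
  invariant : ν = ∑ i, c i • ν.map (f i)

lemma eq_of_sum_mul_eq {a c : ι → ℝ≥0∞} {b : ℝ≥0∞} (hb : b ≠ ∞) (hc : ∀ i, c i ≠ 0)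
    (hc1 : ∑ i, c i = 1) (ha : ∀ i, a i ≤ b) (h : ∑ i, c i * a i = b) (i : ι) : a i = b := by
  have hsum : b + ∑ i, c i * (b - a i) = b := by
    conv_lhs => rw [← h]
    rw [← Finset.sum_add_distrib, h]
    simp_rw [← mul_add, add_tsub_cancel_of_le (ha _)]
    rw [← Finset.sum_mul, hc1, one_mul]
  have hzero : ∑ i, c i * (b - a i) = 0 :=
    (ENNReal.add_right_inj hb).1 (hsum.trans (add_zero b).symm)
  have hi := (mul_eq_zero.1 (Finset.sum_eq_zero_iff.1 hzero i (Finset.mem_univ i))).resolve_left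
    (hc i)
  exact (ha i).antisymm (tsub_eq_zero_iff_le.1 hi)

namespace IsInvariantMeasure

variable {f : ι → X → X} {c : ι → ℝ≥0∞} {ν : Measure X} {A O : Set X}

lemma smul [TopologicalSpace X] (hν : IsInvariantMeasure f c ν) {a : ℝ≥0∞} (ha₀ : a ≠ 0)
    (ha : a ≠ ∞) : IsInvariantMeasure f c (a • ν) where
  isFiniteMeasure := have := hν.isFiniteMeasure; ν.smul_finite ha
  ne_zero := by
    rw [← Measure.measure_univ_ne_zero, Measure.smul_apply, smul_eq_mul]
    exact mul_ne_zero ha₀ (Measure.measure_univ_ne_zero.2 hν.ne_zero)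
  compactly_supported := by
    obtain ⟨K, hK, hK0⟩ := hν.compactly_supported
    exact ⟨K, hK, by rw [Measure.smul_apply, hK0, smul_zero]⟩
  invariant := by
    conv_lhs => rw [hν.invariant]
    simp_rw [Finset.smul_sum, Measure.map_smul, smul_comm a]

section Measurable

variable [TopologicalSpace X]

lemma measure_eq_sum (hν : IsInvariantMeasure f c ν) (hf : ∀ i, Measurable (f i))
    (hA : MeasurableSet A) : ν A = ∑ i, c i * ν (f i ⁻¹' A) := by
  conv_lhs => rw [hν.invariant]
  simp_rw [Measure.finsetSum_apply, Measure.smul_apply, Measure.map_apply (hf _) hA, smul_eq_mul]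

lemma sum_weights (hν : IsInvariantMeasure f c ν) (hf : ∀ i, Measurable (f i)) :
    ∑ i, c i = 1 := by
  have := hν.isFiniteMeasure
  have h := hν.measure_eq_sum hf MeasurableSet.univ
  simp_rw [preimage_univ, ← Finset.sum_mul] at h
  exact (ENNReal.mul_left_inj (Measure.measure_univ_ne_zero.2 hν.ne_zero) (measure_ne_top ν _)).1
    (h.symm.trans (one_mul _).symm)

lemma wordProd_mul_measure_preimage_le (hν : IsInvariantMeasure f c ν)
    (hf : ∀ i, Measurable (f i)) (hA : MeasurableSet A) (w : List ι) :
    wordProd c w * ν (wordMap f w ⁻¹' A) ≤ ν A := by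
  induction w generalizing A with
  | nil => rw [wordProd_nil, wordMap_nil, preimage_id, one_mul]
  | cons i w ih =>
    rw [hν.measure_eq_sum hf hA, wordProd_cons, wordMap_cons, preimage_comp, mul_assoc]
    refine le_trans ?_ (Finset.single_le_sum (f := fun i => c i * ν (f i ⁻¹' A))
      (fun _ _ => zero_le) (Finset.mem_univ i))
    exact mul_le_mul_right (ih (hf i hA)) (c i)

lemma measure_preimage_eq_of_le (hν : IsInvariantMeasure f c ν) (hf : ∀ i, Measurable (f i))
    (hc : ∀ i, c i ≠ 0) (hA : MeasurableSet A) (h : ∀ i, ν (f i ⁻¹' A) ≤ ν A) (i : ι) :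
    ν (f i ⁻¹' A) = ν A :=
  have := hν.isFiniteMeasure
  eq_of_sum_mul_eq (measure_ne_top ν A) hc (hν.sum_weights hf) h
    (hν.measure_eq_sum hf hA).symm i

lemma measure_wordMap_preimage_eq (hν : IsInvariantMeasure f c ν) (hf : ∀ i, Measurable (f i))
    (hc : ∀ i, c i ≠ 0) (hA : MeasurableSet A) (hfA : ∀ i, f i ⁻¹' A ⊆ A) (w : List ι) :
    ν (wordMap f w ⁻¹' A) = ν A := by
  have hsub (w : List ι) : wordMap f w ⁻¹' A ⊆ A := by
    simpa only [mapsTo_iff_subset_preimage, compl_subset_compl, preimage_compl] using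
      mapsTo_wordMap (A := Aᶜ) (fun i => by
        rw [mapsTo_iff_subset_preimage, preimage_compl]
        exact compl_subset_compl.2 (hfA i)) w
  have hmeas (w : List ι) : Measurable (wordMap f w) := by
    induction w with
    | nil => exact measurable_id
    | cons i w ih => exact (hf i).comp ih
  induction w using List.reverseRecOn with
  | nil => rfl
  | append_singleton w i ih =>
    have hwj (j : ι) : f j ⁻¹' (wordMap f w ⁻¹' A) = wordMap f (w ++ [j]) ⁻¹' A := by
      rw [wordMap_concat, preimage_comp]
    rw [← hwj, ← ih]
    refine hν.measure_preimage_eq_of_le hf hc (hmeas w hA) (fun j => ?_) i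
    rw [hwj, ih]
    exact measure_mono (hsub _)

lemma measure_compl_eq_zero_of_wordMap (hν : IsInvariantMeasure f c ν)
    (hf : ∀ i, Measurable (f i)) (hc : ∀ i, c i ≠ 0) (hA : MeasurableSet A)
    (hfA : ∀ i, MapsTo (f i) A A) {w : List ι} (hw : ∀ᵐ x ∂ν, wordMap f w x ∈ A) : ν Aᶜ = 0 := by
  rw [← hν.measure_wordMap_preimage_eq hf hc hA.compl (fun i x hx hxA => hx (hfA i hxA)) w]
  exact hw

lemma measure_image_eq (hν : IsInvariantMeasure f c ν) (hf : ∀ i, MeasurableEmbedding (f i))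
    (hO : ν Oᶜ = 0) (hdisj : ∀ i j, i ≠ j → Disjoint (f i '' O) (f j '' O))
    (hA : MeasurableSet A) (hAO : A ⊆ O) (i : ι) : ν (f i '' A) = c i * ν A := by
  rw [hν.measure_eq_sum (fun j => (hf j).measurable) ((hf i).measurableSet_image' hA),
    Finset.sum_eq_single i, preimage_image_eq _ (hf i).injective]
  · intro j _ hji
    refine mul_eq_zero_of_right _ (measure_mono_null (t := Oᶜ) (fun x hx hxO => ?_) hO)
    exact (hdisj j i hji).le_bot ⟨mem_image_of_mem _ hxO, image_mono hAO hx⟩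
  · exact fun h => (h (Finset.mem_univ i)).elim

lemma measure_image_wordMap_eq (hν : IsInvariantMeasure f c ν)
    (hf : ∀ i, MeasurableEmbedding (f i)) (hO : ν Oᶜ = 0) (hfO : ∀ i, MapsTo (f i) O O)
    (hdisj : ∀ i j, i ≠ j → Disjoint (f i '' O) (f j '' O)) (hA : MeasurableSet A) (hAO : A ⊆ O)
    (w : List ι) : ν (wordMap f w '' A) = wordProd c w * ν A := by
  have hemb (w : List ι) : MeasurableEmbedding (wordMap f w) := by
    induction w with
    | nil => exact MeasurableEmbedding.id
    | cons i w ih => exact (hf i).comp ih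
  induction w with
  | nil => rw [wordMap_nil, image_id, wordProd_nil, one_mul]
  | cons i w ih =>
    have hwO : wordMap f w '' A ⊆ O := ((mapsTo_wordMap hfO w).mono_left hAO).image_subset
    rw [wordMap_cons, image_comp, wordProd_cons, mul_assoc, ← ih]
    exact hν.measure_image_eq hf hO hdisj ((hemb w).measurableSet_image' hA) hwO i

end Measurable

lemma measure_compl_eq_zero [MetricSpace X] [BorelSpace X]
    (hν : IsInvariantMeasure f c ν) {q : NNReal} (hq : q < 1) (hf : ∀ i, LipschitzWith q (f i))
    {E : Set X} (hE : IsCompact E) (hne : E.Nonempty) (hfE : ∀ i, MapsTo (f i) E E) :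
    ν Eᶜ = 0 := by
  have := hν.isFiniteMeasure
  obtain ⟨x₀, hx₀⟩ := hne
  obtain ⟨K, hK, hK0⟩ := hν.compactly_supported
  obtain ⟨R, hKR⟩ := hK.isBounded.subset_closedBall x₀
  have hshrink (R : ℝ) (h : ν (Metric.cthickening R E)ᶜ = 0) :
      ν (Metric.cthickening (q * R) E)ᶜ = 0 := by
    rw [hν.measure_eq_sum (fun i => (hf i).continuous.measurable)
      Metric.isClosed_cthickening.measurableSet.compl]
    refine Finset.sum_eq_zero fun i _ => mul_eq_zero_of_right _ (measure_mono_null ?_ h)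
    exact fun x hx hxR => hx (mapsTo_cthickening_of_lipschitzWith (hf i) (hfE i) R hxR)
  have hpow (k : ℕ) : ν (Metric.cthickening (q ^ k * max R 0) E)ᶜ = 0 := by
    induction k with
    | zero =>
      refine measure_mono_null (compl_subset_compl.2 (hKR.trans ?_)) hK0
      rw [pow_zero, one_mul]
      exact (Metric.closedBall_subset_closedBall (le_max_left _ _)).trans
        (Metric.closedBall_subset_cthickening hx₀ _)
    | succ k ih =>
      rw [pow_succ', mul_assoc]
      exact hshrink _ ih
  have hlim : Tendsto (fun k : ℕ => (q : ℝ) ^ k * max R 0) atTop (𝓝 0) := by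
    simpa only [zero_mul] using (tendsto_pow_atTop_nhds_zero_of_lt_one q.coe_nonneg
      (NNReal.coe_lt_one.2 hq)).mul_const (max R 0)
  have hνE : ν E = ν univ := tendsto_nhds_unique
    ((tendsto_measure_cthickening_of_isClosed ⟨1, one_pos, measure_ne_top _ _⟩
      hE.isClosed).comp hlim)
    (by simp only [Function.comp_def, measure_of_measure_compl_eq_zero (hpow _),
      tendsto_const_nhds])
  rw [measure_compl hE.measurableSet (measure_ne_top ν E), hνE, tsub_self]

end IsInvariantMeasure

end InvariantMeasure

lemma density_image_eq {X Y : Type*} [PseudoMetricSpace X] [PseudoMetricSpace Y] {t s : ℝ}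
    {α : Set X → ℝ≥0∞} {β : Set Y → ℝ≥0∞} {g : X → Y}
    (hg : IsSimilitude t g) (hs : Function.Surjective g) {x : X} {d : ℝ}
    (h : β (g '' Metric.closedBall x d) =
      ENNReal.ofReal (t ^ s) * α (Metric.closedBall x d)) :
    density β s (g x) (t * d) = density α s x d := by
  rw [density, density, ← hg.image_closedBall hs, h, mul_left_comm, ENNReal.ofReal_mul hg.pos.le,
    ENNReal.mul_rpow_of_ne_top ENNReal.ofReal_ne_top ENNReal.ofReal_ne_top,
    ENNReal.ofReal_rpow_of_pos hg.pos]
  exact ENNReal.mul_div_mul_left _ _ (ENNReal.ofReal_pos.2 (Real.rpow_pos_of_pos hg.pos s)).ne'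
    ENNReal.ofReal_ne_top

/-- The weights `r i ^ s` of the natural measure. -/
noncomputable abbrev similarityWeight {ι : Type*} (r : ι → ℝ) (s : ℝ) (i : ι) : ℝ≥0∞ :=
  ENNReal.ofReal (r i ^ s)

section NaturalMeasure

variable {n m : ℕ} {f : Fin m → EuclideanSpace ℝ (Fin n) → EuclideanSpace ℝ (Fin n)}
  {r : Fin m → ℝ} {s : ℝ} {E O A : Set (EuclideanSpace ℝ (Fin n))}
  {μ ν : Measure (EuclideanSpace ℝ (Fin n))}

lemma IsNaturalMeasure.isInvariantMeasure (hμ : IsNaturalMeasure f r s μ) :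
    IsInvariantMeasure f (similarityWeight r s) μ :=
  have := hμ.isProbabilityMeasure
  ⟨inferInstance, IsProbabilityMeasure.ne_zero μ, hμ.compactly_supported, hμ.invariant⟩

lemma IsSimilitudeSystem.similarityWeight_ne_zero (hf : IsSimilitudeSystem f r) (s : ℝ)
    (i : Fin m) : similarityWeight r s i ≠ 0 :=
  (ENNReal.ofReal_pos.2 (Real.rpow_pos_of_pos (hf i).1 s)).ne'

namespace IsInvariantMeasure

variable (hf : IsSimilitudeSystem f r) (hE : IsSelfSimilarSet f E)
  (hν : IsInvariantMeasure f (similarityWeight r s) ν)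

include hf hE hν

lemma measure_compl_attractor : ν Eᶜ = 0 := by
  obtain ⟨q, -, hq1, hq⟩ := hf.exists_ratio_upperBound
  exact hν.measure_compl_eq_zero (Real.toNNReal_lt_one.2 hq1)
    (fun i => (hf.isSimilitude i).lipschitzWith.weaken (Real.toNNReal_mono (hq i)))
    hE.isCompact hE.nonempty hE.mapsTo

lemma measure_compl_eq_zero_of_image_subset (hA : MeasurableSet A)
    (hfA : ∀ i, MapsTo (f i) A A) {w : List (Fin m)} (hw : wordMap f w '' E ⊆ A) : ν Aᶜ = 0 :=
  hν.measure_compl_eq_zero_of_wordMap (fun i => (hf.isSimilitude i).continuous.measurable)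
    (hf.similarityWeight_ne_zero s) hA hfA
    (measure_mono_null (fun _ hx hxE => hx (hw (mem_image_of_mem _ hxE)))
      (hν.measure_compl_attractor hf hE))

lemma measure_compl_feasible (hO : IsFeasible f E O) : ν Oᶜ = 0 := by
  obtain ⟨x, hxO, hxE⟩ := hO.inter_nonempty
  obtain ⟨ε, hε, hεO⟩ := Metric.nhds_basis_closedBall.mem_iff.1 (hO.isOpen.mem_nhds hxO)
  obtain ⟨w, -, hw⟩ := hE.exists_word_subset_closedBall hf hxE hε
  exact hν.measure_compl_eq_zero_of_image_subset hf hE hO.isOpen.measurableSet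
    (fun i => mapsTo_iff_image_subset.2 (hO.image_subset i)) (hw.trans hεO)

lemma density_wordMap (hO : IsFeasible f E O) {x : EuclideanSpace ℝ (Fin n)} {d : ℝ}
    (hx : Metric.closedBall x d ⊆ O) (w : List (Fin m)) :
    density ν s (wordMap f w x) (wordProd r w * d) = density ν s x d := by
  have hw := hf.isSimilitude_wordMap w
  refine density_image_eq hw hw.surjective ?_
  rw [← wordProd_ofReal_rpow (fun i => (hf i).1)]
  exact hν.measure_image_wordMap_eq (fun i => (hf.isSimilitude i).measurableEmbedding)
    (hν.measure_compl_feasible hf hE hO) (fun i => mapsTo_iff_image_subset.2 (hO.image_subset i))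
    hO.disjoint Metric.isClosed_closedBall.measurableSet hx w

end IsInvariantMeasure

end NaturalMeasure

lemma le_of_forall_wordProd_mem_Icc {ι N : Type*} [Fintype ι] [AddCommMonoid N] [PartialOrder N]
    [IsOrderedAddMonoid N] {r : ι → ℝ} {p q R : ℝ} (hp : 0 < p) (hpr : ∀ i, p ≤ r i)
    (hq0 : 0 < q) (hq1 : q < 1) (hqr : ∀ i, r i ≤ q) (hR : 0 < R) (hpR : p * R ≤ 1)
    {Φ Ψ : List ι → N} (hΦ : ∀ w, Φ w ≤ ∑ i, Φ (w ++ [i])) (hΨ : ∀ w, ∑ i, Ψ (w ++ [i]) ≤ Ψ w)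
    (h : ∀ w, wordProd r w ∈ Icc (p * R) R → Φ w ≤ Ψ w) : Φ [] ≤ Ψ [] := by
  have hlong (k : ℕ) (w : List ι) (hw : p * R ≤ wordProd r w) (hk : wordProd r w * q ^ k ≤ R) :
      Φ w ≤ Ψ w := by
    induction k generalizing w with
    | zero => exact h w ⟨hw, by rwa [pow_zero, mul_one] at hk⟩
    | succ k ih =>
      rcases le_or_gt (wordProd r w) R with hwR | hwR
      · exact h w ⟨hw, hwR⟩
      refine (hΦ w).trans ((Finset.sum_le_sum fun i _ => ih (w ++ [i]) ?_ ?_).trans (hΨ w)) <;>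
        rw [wordProd_concat]
      · rw [mul_comm p]
        exact mul_le_mul hwR.le (hpr i) hp.le (hR.trans hwR).le
      · refine le_trans ?_ hk
        rw [pow_succ', ← mul_assoc]
        have := hR.trans hwR
        gcongr
        exact hqr i
  obtain ⟨k, hk⟩ := exists_pow_lt_of_lt_one hR hq1
  exact hlong k [] hpR (by rw [wordProd_nil, one_mul]; exact hk.le)

lemma IsSimilitude.ball_subset_inter_image {X Y : Type*} [PseudoMetricSpace X]
    [PseudoMetricSpace Y] {t : ℝ} {g : X → Y} (hg : IsSimilitude t g)
    (hs : Function.Surjective g) {O : Set X} {x₀ y : X} {x : Y} {a ρ D R : ℝ} (htR : t ≤ R)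
    (haρ : a ≤ t * ρ) (hρ : 0 ≤ ρ) (hO : Metric.ball x₀ ρ ⊆ O) (hD : dist x₀ y ≤ D)
    (hy : g y ∈ Metric.closedBall x R) :
    Metric.ball (g x₀) a ⊆ Metric.ball x ((1 + D + ρ) * R) ∩ g '' O := by
  intro z hz
  obtain ⟨z, rfl⟩ := hs z
  have hzx₀ : t * dist z x₀ < t * ρ := by
    rw [← hg.dist_eq]
    exact (Metric.mem_ball.1 hz).trans_le haρ
  refine ⟨?_, mem_image_of_mem _ (hO (lt_of_mul_lt_mul_left hzx₀ hg.pos.le))⟩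
  have htρ : t * ρ ≤ R * ρ := mul_le_mul_of_nonneg_right htR hρ
  have htD : t * dist x₀ y ≤ R * D := mul_le_mul htR hD dist_nonneg (hg.pos.le.trans htR)
  have hgy := Metric.mem_closedBall.1 hy
  have htri := dist_triangle4 (g z) (g x₀) (g y) x
  rw [hg.dist_eq, hg.dist_eq] at htri
  rw [Metric.mem_ball]
  linarith

lemma sum_measure_image_comp_le {ι X Y : Type*} [Fintype ι] [MeasurableSpace Y]
    (μ : Measure Y) {f : ι → X → X} {g : X → Y} {O : Set X} (hg : Function.Injective g)
    (hfO : ∀ i, f i '' O ⊆ O) (hdisj : ∀ i j, i ≠ j → Disjoint (f i '' O) (f j '' O))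
    (hmeas : ∀ i, MeasurableSet ((g ∘ f i) '' O)) :
    ∑ i, μ ((g ∘ f i) '' O) ≤ μ (g '' O) := by
  rw [← tsum_fintype (L := .unconditional ι), ← measure_iUnion (fun i j hij => ?_) hmeas]
  · refine measure_mono (iUnion_subset fun i => ?_)
    rw [image_comp]
    exact image_mono (hfO i)
  · simp only [Function.onFun, image_comp]
    exact (disjoint_image_iff hg).2 (hdisj i j hij)

section DensityBounds

variable {n m : ℕ} {f : Fin m → EuclideanSpace ℝ (Fin n) → EuclideanSpace ℝ (Fin n)}
  {r : Fin m → ℝ} {s : ℝ} {E O : Set (EuclideanSpace ℝ (Fin n))}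
  {ν : Measure (EuclideanSpace ℝ (Fin n))}

namespace IsInvariantMeasure

lemma exists_le_density (hf : IsSimilitudeSystem f r) (hE : IsSelfSimilarSet f E) (hs : 0 < s)
    (hν : IsInvariantMeasure f (similarityWeight r s) ν) :
    ∃ c ≠ 0, ∀ᶠ d in 𝓝[>] 0, ∀ x ∈ E, c ≤ density ν s x d := by
  obtain ⟨p, hp0, -, hp⟩ := hf.exists_ratio_lowerBound
  obtain ⟨D, hD1, hD⟩ := hE.exists_dist_le
  have hD0 : 0 < D := one_pos.trans_le hD1
  refine ⟨ENNReal.ofReal (p / (2 * D)) ^ s * ν univ, mul_ne_zero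
    (ENNReal.rpow_pos (ENNReal.ofReal_pos.2 (by positivity)) ENNReal.ofReal_ne_top).ne'
    (Measure.measure_univ_ne_zero.2 hν.ne_zero), ?_⟩
  filter_upwards [Ioc_mem_nhdsGT one_pos] with d ⟨hd0, hd1⟩ x hx
  obtain ⟨w, ⟨x, hxE, rfl⟩, hpw, hwd⟩ := hE.exists_word_wordProd_mem_Icc hf hp hx
    (η := d / D) (by positivity) ((div_le_one hD0).2 (hd1.trans hD1))
  have hw := hf.isSimilitude_wordMap w
  have hfull : ν (wordMap f w ⁻¹' Metric.closedBall (wordMap f w x) d) = ν univ := by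
    refine measure_of_measure_compl_eq_zero
      (measure_mono_null (compl_subset_compl.2 fun y hy => ?_) (hν.measure_compl_attractor hf hE))
    rw [mem_preimage, Metric.mem_closedBall, hw.dist_eq]
    exact (mul_le_mul_of_nonneg_left (hD y hy x hxE) hw.pos.le).trans ((le_div_iff₀ hD0).1 hwd)
  rw [le_density_iff hd0]
  calc ENNReal.ofReal (p / (2 * D)) ^ s * ν univ * ENNReal.ofReal (2 * d) ^ s
      = ENNReal.ofReal (p * (d / D)) ^ s * ν univ := by
        rw [mul_right_comm, ← ENNReal.mul_rpow_of_nonneg _ _ hs.le,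
          ← ENNReal.ofReal_mul (by positivity)]
        congr 3
        field_simp
    _ ≤ wordProd (similarityWeight r s) w * ν univ := by
        rw [wordProd_ofReal_rpow (fun i => (hf i).1), ← ENNReal.ofReal_rpow_of_pos hw.pos]
        gcongr
    _ ≤ ν (Metric.closedBall (wordMap f w x) d) := by
        rw [← hfull]
        exact hν.wordProd_mul_measure_preimage_le
          (fun i => (hf.isSimilitude i).continuous.measurable)
          Metric.isClosed_closedBall.measurableSet w

lemma wordProd_mul_measure_preimage_mul_volume_le (hf : IsSimilitudeSystem f r)
    (hE : IsSelfSimilarSet f E) (hs : 0 < s)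
    (hν : IsInvariantMeasure f (similarityWeight r s) ν) {p ρ D R : ℝ} (hρ : 0 < ρ)
    {x₀ : EuclideanSpace ℝ (Fin n)} (hO : Metric.ball x₀ ρ ⊆ O) (hD : ∀ y ∈ E, dist x₀ y ≤ D)
    (x : EuclideanSpace ℝ (Fin n)) {w : List (Fin m)} (hw : wordProd r w ∈ Icc (p * R) R) :
    wordProd (similarityWeight r s) w * ν (wordMap f w ⁻¹' Metric.closedBall x R) *
        volume (Metric.ball (0 : EuclideanSpace ℝ (Fin n)) (p * R * ρ)) ≤
      ENNReal.ofReal (R ^ s) * ν univ *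
        volume (Metric.ball x ((1 + D + ρ) * R) ∩ wordMap f w '' O) := by
  have hsim := hf.isSimilitude_wordMap w
  by_cases hmeet : ∃ y ∈ E, wordMap f w y ∈ Metric.closedBall x R
  · obtain ⟨y, hy, hyx⟩ := hmeet
    rw [wordProd_ofReal_rpow (fun i => (hf i).1),
      ← Measure.addHaar_ball_center volume (wordMap f w x₀)]
    refine mul_le_mul' (mul_le_mul' ?_ (measure_mono (subset_univ _))) (measure_mono ?_)
    · exact ENNReal.ofReal_le_ofReal (Real.rpow_le_rpow hsim.pos.le hw.2 hs.le)
    · exact hsim.ball_subset_inter_image hsim.surjective hw.2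
        (mul_le_mul_of_nonneg_right hw.1 hρ.le) hρ.le hO (hD y hy) hyx
  · have hnull : ν (wordMap f w ⁻¹' Metric.closedBall x R) = 0 :=
      measure_mono_null (fun y hyx hy => hmeet ⟨y, hy, hyx⟩) (hν.measure_compl_attractor hf hE)
    rw [hnull, mul_zero, zero_mul]
    exact zero_le

/-- Cut the ball `closedBall x R` along the cylinders of size about `R`: each one carries mass at
most of order `R ^ s`, and contains its own ball of radius about `R` in the corresponding copy of
`O`. These copies are disjoint. -/
lemma measure_closedBall_mul_volume_le (hf : IsSimilitudeSystem f r) (hE : IsSelfSimilarSet f E)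
    (hs : 0 < s) (hν : IsInvariantMeasure f (similarityWeight r s) ν) (hO : IsFeasible f E O)
    {p ρ D R : ℝ} (hp : 0 < p) (hpr : ∀ i, p ≤ r i) (hρ : 0 < ρ) {x₀ : EuclideanSpace ℝ (Fin n)}
    (hx₀ : Metric.ball x₀ ρ ⊆ O) (hD : ∀ y ∈ E, dist x₀ y ≤ D) (x : EuclideanSpace ℝ (Fin n))
    (hR : 0 < R) (hpR : p * R ≤ 1) :
    ν (Metric.closedBall x R) *
        volume (Metric.ball (0 : EuclideanSpace ℝ (Fin n)) (p * R * ρ)) ≤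
      ENNReal.ofReal (R ^ s) * ν univ * volume (Metric.ball x ((1 + D + ρ) * R)) := by
  obtain ⟨q, hq0, hq1, hq⟩ := hf.exists_ratio_upperBound
  set U := Metric.ball x ((1 + D + ρ) * R)
  have hcut := le_of_forall_wordProd_mem_Icc hp hpr hq0 hq1 hq hR hpR
    (Φ := fun w => wordProd (similarityWeight r s) w *
      ν (wordMap f w ⁻¹' Metric.closedBall x R) *
        volume (Metric.ball (0 : EuclideanSpace ℝ (Fin n)) (p * R * ρ)))
    (Ψ := fun w => ENNReal.ofReal (R ^ s) * ν univ * volume (U ∩ wordMap f w '' O))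
    (fun w => ?_) (fun w => ?_)
    (fun w hw => hν.wordProd_mul_measure_preimage_mul_volume_le hf hE hs hρ hx₀ hD x hw)
  · rw [wordProd_nil, one_mul, wordMap_nil, preimage_id] at hcut
    exact hcut.trans (mul_le_mul_right (measure_mono inter_subset_left) _)
  · have hfm (i : Fin m) : Measurable (f i) := (hf.isSimilitude i).continuous.measurable
    rw [← Finset.sum_mul, hν.measure_eq_sum hfm
      ((hf.isSimilitude_wordMap w).continuous.measurable Metric.isClosed_closedBall.measurableSet),
      Finset.mul_sum]
    refine (mul_le_mul_left (Finset.sum_congr rfl fun i _ => ?_).le _)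
    rw [wordProd_concat, wordMap_concat, mul_assoc, preimage_comp]
  · rw [← Finset.mul_sum]
    refine mul_le_mul_right ?_ _
    have himage (w : List (Fin m)) : MeasurableSet (wordMap f w '' O) :=
      (hf.isSimilitude_wordMap w).measurableEmbedding.measurableSet_image' hO.isOpen.measurableSet
    have hsum := sum_measure_image_comp_le (volume.restrict U)
      (hf.isSimilitude_wordMap w).injective hO.image_subset hO.disjoint
      fun i => by simpa only [wordMap_concat] using himage (w ++ [i])
    simp only [← wordMap_concat] at hsum
    simpa only [Measure.restrict_apply (himage _), inter_comm U] using hsum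

lemma exists_density_le (hf : IsSimilitudeSystem f r) (hE : IsSelfSimilarSet f E) (hs : 0 < s)
    (hν : IsInvariantMeasure f (similarityWeight r s) ν) (hO : IsFeasible f E O) :
    ∃ c ≠ ∞, ∀ᶠ d in 𝓝[>] 0, ∀ x, density ν s x d ≤ c := by
  have := hν.isFiniteMeasure
  obtain ⟨p, hp0, hp1, hp⟩ := hf.exists_ratio_lowerBound
  obtain ⟨D, hD1, hD⟩ := hE.exists_dist_le
  obtain ⟨x₀, hx₀O, hx₀⟩ := hO.inter_nonempty
  obtain ⟨ρ, hρ, hρO⟩ := Metric.isOpen_iff.1 hO.isOpen x₀ hx₀O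
  set L := (1 + D + ρ) / (p * ρ) with hL
  have hL0 : 0 < L := by positivity
  refine ⟨ENNReal.ofReal (L ^ n) * ν univ,
    ENNReal.mul_ne_top ENNReal.ofReal_ne_top (measure_ne_top ν _), ?_⟩
  filter_upwards [Ioc_mem_nhdsGT one_pos] with d ⟨hd0, hd1⟩ x
  have hvol : volume (Metric.ball x ((1 + D + ρ) * d)) = ENNReal.ofReal (L ^ n) *
      volume (Metric.ball (0 : EuclideanSpace ℝ (Fin n)) (p * d * ρ)) := by
    rw [show (1 + D + ρ) * d = L * (p * d * ρ) by rw [hL]; field_simp,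
      Measure.addHaar_ball_mul_of_pos _ _ hL0, finrank_euclideanSpace_fin]
  have hcut := hν.measure_closedBall_mul_volume_le hf hE hs hO hp0 hp hρ hρO (hD x₀ hx₀) x hd0
    (mul_le_one₀ hp1.le hd0.le hd1)
  rw [hvol, ← mul_assoc, ENNReal.mul_le_mul_iff_left
    (Metric.measure_ball_pos _ _ (by positivity)).ne' measure_ball_lt_top.ne] at hcut
  rw [density_le_iff hd0]
  calc ν (Metric.closedBall x d)
      ≤ ENNReal.ofReal (L ^ n) * ν univ * ENNReal.ofReal d ^ s := by
        rw [ENNReal.ofReal_rpow_of_pos hd0]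
        exact hcut.trans_eq (by ring)
    _ ≤ ENNReal.ofReal (L ^ n) * ν univ * ENNReal.ofReal (2 * d) ^ s := by
        gcongr
        linarith

end IsInvariantMeasure

end DensityBounds

section Continuity

variable {X : Type*} [PseudoMetricSpace X] [MeasurableSpace X]

lemma monotone_measure_closedBall (ν : Measure X) (x : X) :
    Monotone fun d => ν (Metric.closedBall x d) :=
  fun _ _ h => measure_mono (Metric.closedBall_subset_closedBall h)

variable [OpensMeasurableSpace X]

lemma tendsto_measure_closedBall (ν : Measure X) [IsFiniteMeasure ν] (x : X) (d : ℝ) :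
    Tendsto (fun e => ν (Metric.closedBall x e)) (𝓝[>] d) (𝓝 (ν (Metric.closedBall x d))) := by
  rw [← Metric.biInter_gt_closedBall]
  exact tendsto_measure_biInter_gt (fun _ _ => Metric.isClosed_closedBall.nullMeasurableSet)
    (fun _ _ _ h => Metric.closedBall_subset_closedBall h)
    ⟨d + 1, lt_add_one d, measure_ne_top ν _⟩

-- The enlarged balls decrease to `closedBall x d` even though the centres move.
lemma tendsto_density_of_dist_le {ι : Type*} {l : Filter ι} {ν : Measure X} [IsFiniteMeasure ν]
    {s : ℝ} {x : X} {d : ℝ} (hd : 0 < d) {z : ι → X} {η : ι → ℝ} (hη : Tendsto η l (𝓝[>] 0))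
    (hz : ∀ i, dist (z i) x ≤ η i) :
    Tendsto (fun i => density ν s (z i) (d + η i)) l (𝓝 (density ν s x d)) := by
  obtain ⟨hη₀, hηpos⟩ := tendsto_nhdsWithin_iff.1 hη
  have hupper : Tendsto (fun i => ν (Metric.closedBall x (d + 2 * η i))) l
      (𝓝 (ν (Metric.closedBall x d))) := by
    refine (tendsto_measure_closedBall ν x d).comp (tendsto_nhdsWithin_iff.2 ⟨?_, ?_⟩)
    · simpa only [mul_zero, add_zero] using (hη₀.const_mul 2).const_add d
    · filter_upwards [hηpos] with i hi
      exact lt_add_of_pos_right d (mul_pos two_pos hi)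
  have hnum : Tendsto (fun i => ν (Metric.closedBall (z i) (d + η i))) l
      (𝓝 (ν (Metric.closedBall x d))) :=
    tendsto_of_tendsto_of_tendsto_of_le_of_le tendsto_const_nhds hupper
      (fun i => measure_mono (Metric.closedBall_subset_closedBall'
        (by rw [dist_comm]; linarith [hz i])))
      (fun i => measure_mono (Metric.closedBall_subset_closedBall' (by linarith [hz i])))
  have hden : Tendsto (fun i => ENNReal.ofReal (2 * (d + η i)) ^ s) l
      (𝓝 (ENNReal.ofReal (2 * d) ^ s)) := by
    have hrad : Tendsto (fun i => d + η i) l (𝓝 d) := by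
      simpa only [add_zero] using hη₀.const_add d
    simpa only [one_mul, Function.comp_def] using (tendsto_mul_rpow hd 1).comp hrad
  exact ENNReal.Tendsto.div hnum (Or.inr (ofReal_two_mul_rpow_ne_zero hd)) hden
    (Or.inl (ofReal_two_mul_rpow_ne_top hd))

end Continuity

lemma wordProd_le_pow {ι : Type*} {r : ι → ℝ} {q : ℝ} (hr : ∀ i, 0 ≤ r i) (hq : ∀ i, r i ≤ q)
    (w : List ι) : wordProd r w ≤ q ^ w.length := by
  induction w with
  | nil => rfl
  | cons i w ih =>
    rw [wordProd_cons, List.length_cons, pow_succ']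
    exact (mul_le_mul_of_nonneg_left ih (hr i)).trans
      (mul_le_mul_of_nonneg_right (hq i) (pow_nonneg ((hr i).trans (hq i)) _))

/-- The rich points of `E`: those having, for every finite word `v`, addresses in which `v` occurs
arbitrarily late. Their spectrum sees the density of every typical ball. -/
def richPoints {ι X : Type*} (f : ι → X → X) (E : Set X) : Set X :=
  ⋂ (v : List ι) (k : ℕ), ⋃ (w : List ι) (_ : k ≤ w.length), wordMap f w '' (wordMap f v '' E)

/-- The set `Ê` of the paper: the rich points of `E` that lie in the feasible open set `O`. -/
def genericPoints {ι X : Type*} (f : ι → X → X) (E O : Set X) : Set X :=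
  richPoints f E ∩ (O ∩ E)

section Generic

variable {n m : ℕ} {f : Fin m → EuclideanSpace ℝ (Fin n) → EuclideanSpace ℝ (Fin n)}
  {r : Fin m → ℝ} {s : ℝ} {E O A : Set (EuclideanSpace ℝ (Fin n))}
  {ν : Measure (EuclideanSpace ℝ (Fin n))} {x y : EuclideanSpace ℝ (Fin n)} {d : ℝ}

lemma measurableSet_iUnion_image_wordMap (hf : IsSimilitudeSystem f r) (hE : IsSelfSimilarSet f E)
    (v : List (Fin m)) (k : ℕ) : MeasurableSet (⋃ (w : List (Fin m)) (_ : k ≤ w.length),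
      wordMap f w '' (wordMap f v '' E)) :=
  MeasurableSet.iUnion fun w => MeasurableSet.iUnion fun _ =>
    ((hE.isCompact.image (hf.isSimilitude_wordMap v).continuous).image
      (hf.isSimilitude_wordMap w).continuous).measurableSet

lemma measurableSet_genericPoints (hf : IsSimilitudeSystem f r) (hE : IsSelfSimilarSet f E)
    (hO : IsFeasible f E O) : MeasurableSet (genericPoints f E O) :=
  (MeasurableSet.iInter fun v => MeasurableSet.iInter fun k =>
    measurableSet_iUnion_image_wordMap hf hE v k).inter
      (hO.isOpen.measurableSet.inter hE.isCompact.measurableSet)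

lemma IsFeasible.Ioo_subset_typicalDensities (hO : IsFeasible f E O) (hy : y ∈ O ∩ E) :
    Ioo (lowerDensity ν s y) (upperDensity ν s y) ⊆ typicalDensities f E ν s := fun L hL => by
  obtain ⟨ε, hε, hεO⟩ := Metric.nhds_basis_closedBall.mem_iff.1 (hO.isOpen.mem_nhds hy.1)
  obtain ⟨d, hd, hdL⟩ := (nhdsGT_basis (0 : ℝ)).frequently_iff.1
    (frequently_density_eq (monotone_measure_closedBall ν y) hL) ε hε
  exact ⟨y, d, ⟨hy.2, hd.1, O, hO, (Metric.closedBall_subset_closedBall hd.2.le).trans hεO⟩,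
    hdL.symm⟩

namespace IsInvariantMeasure

variable (hf : IsSimilitudeSystem f r) (hE : IsSelfSimilarSet f E)
  (hν : IsInvariantMeasure f (similarityWeight r s) ν)

include hf hE hν

lemma richPoints_mem_ae : richPoints f E ∈ ae ν := by
  obtain ⟨i⟩ : Nonempty (Fin m) := by
    by_contra h
    rw [not_nonempty_iff] at h
    have hsum := hν.sum_weights fun i => (hf.isSimilitude i).continuous.measurable
    rw [Finset.univ_eq_empty, Finset.sum_empty] at hsum
    exact zero_ne_one hsum
  refine countable_iInter_mem.2 fun v => countable_iInter_mem.2 fun k => ?_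
  refine hν.measure_compl_eq_zero_of_image_subset hf hE
    (measurableSet_iUnion_image_wordMap hf hE v k) ?_ (w := List.replicate k i ++ v) ?_
  · intro j x hx
    obtain ⟨w, hw, y, hy, rfl⟩ := mem_iUnion₂.1 hx
    exact mem_iUnion₂.2 ⟨j :: w, hw.trans (Nat.le_succ _), y, hy, rfl⟩
  · rw [wordMap_append, image_comp]
    exact subset_iUnion₂_of_subset (List.replicate k i) List.length_replicate.ge Subset.rfl

lemma genericPoints_mem_ae (hO : IsFeasible f E O) : genericPoints f E O ∈ ae ν :=
  inter_mem (hν.richPoints_mem_ae hf hE)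
    (inter_mem (hν.measure_compl_feasible hf hE hO) (hν.measure_compl_attractor hf hE))

lemma nonempty_genericPoints (hO : IsFeasible f E O) : (genericPoints f E O).Nonempty :=
  have : NeZero ν := ⟨hν.ne_zero⟩
  Filter.nonempty_of_mem (hν.genericPoints_mem_ae hf hE hO)

lemma exists_word_density_eq (hO : IsFeasible f E O) (hx : x ∈ E) {η : ℝ} (hη : 0 < η)
    (hxO : Metric.closedBall x (d + 2 * η) ⊆ O) (hy : y ∈ richPoints f E) (k : ℕ) :
    ∃ w : List (Fin m), k ≤ w.length ∧ ∃ z, dist z x ≤ η ∧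
      density ν s y (wordProd r w * (d + η)) = density ν s z (d + η) := by
  obtain ⟨v, -, hv⟩ := hE.exists_word_subset_closedBall hf hx hη
  obtain ⟨w, hw, z, hz, rfl⟩ := mem_iUnion₂.1 (mem_iInter₂.1 hy v k)
  have hzx : dist z x ≤ η := hv hz
  exact ⟨w, hw, z, hzx, hν.density_wordMap hf hE hO
    ((Metric.closedBall_subset_closedBall' (by linarith)).trans hxO) w⟩

lemma density_mem_Spec (hx : IsTypicalBall f E x d) (hy : y ∈ richPoints f E) :
    density ν s x d ∈ Spec ν s {y} := by
  have := hν.isFiniteMeasure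
  obtain ⟨q, hq0, hq1, hq⟩ := hf.exists_ratio_upperBound
  obtain ⟨hxE, hd, O, hO, hxO⟩ := hx
  obtain ⟨ε, hε, hεO⟩ := (isCompact_closedBall x d).exists_cthickening_subset_open hO.isOpen hxO
  rw [cthickening_closedBall hε.le hd.le] at hεO
  obtain ⟨η, -, hη, hη₀⟩ := exists_seq_strictAnti_tendsto' (half_pos hε)
  choose w hw z hz hwz using fun k => hν.exists_word_density_eq (d := d) hf hE hO hxE (hη k).1
    ((Metric.closedBall_subset_closedBall (by linarith [(hη k).2])).trans hεO) hy k
  have hpos (k : ℕ) : 0 < wordProd r (w k) := (hf.isSimilitude_wordMap (w k)).pos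
  have hle (k : ℕ) : wordProd r (w k) ≤ q ^ k :=
    (wordProd_le_pow (fun i => (hf i).1.le) hq (w k)).trans
      (pow_le_pow_of_le_one hq0.le hq1.le (hw k))
  refine ⟨y, rfl, fun k => wordProd r (w k) * (d + η k),
    fun k => mul_pos (hpos k) (add_pos hd (hη k).1), ?_, ?_⟩
  · have hprod : Tendsto (fun k => wordProd r (w k)) atTop (𝓝 0) :=
      squeeze_zero (fun k => (hpos k).le) hle (tendsto_pow_atTop_nhds_zero_of_lt_one hq0.le hq1)
    simpa only [zero_mul] using hprod.mul (hη₀.const_add d)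
  · simp only [hwz]
    exact tendsto_density_of_dist_le hd
      (tendsto_nhdsWithin_iff.2 ⟨hη₀, Eventually.of_forall fun k => (hη k).1⟩) hz

lemma typicalDensities_subset_Spec (hy : y ∈ richPoints f E) :
    typicalDensities f E ν s ⊆ Spec ν s {y} := by
  rintro _ ⟨x, d, hx, rfl⟩
  exact hν.density_mem_Spec hf hE hx hy

lemma Spec_singleton_eq (hO : IsFeasible f E O) (hy : y ∈ genericPoints f E O) :
    Spec ν s {y} = Spec ν s (O ∩ E) := by
  refine (Spec_mono (singleton_subset_iff.2 hy.2)).antisymm ?_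
  rintro L ⟨x, hx, d, hd, hd₀, hL⟩
  obtain ⟨ε, hε, hεO⟩ := Metric.nhds_basis_closedBall.mem_iff.1 (hO.isOpen.mem_nhds hx.1)
  refine (isClosed_Spec_singleton y).mem_of_tendsto hL ?_
  filter_upwards [hd₀.eventually (gt_mem_nhds hε)] with k hk
  exact hν.density_mem_Spec hf hE ⟨hx.2, hd k, O, hO,
    (Metric.closedBall_subset_closedBall hk.le).trans hεO⟩ hy.1

lemma Spec_genericPoints_eq (hO : IsFeasible f E O) (hy : y ∈ genericPoints f E O) :
    Spec ν s (genericPoints f E O) = Spec ν s (O ∩ E) :=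
  (Spec_mono inter_subset_right).antisymm
    (hν.Spec_singleton_eq hf hE hO hy ▸ Spec_mono (singleton_subset_iff.2 hy))

lemma exists_Spec_subset_Icc (hs : 0 < s) (hO : IsFeasible f E O) :
    ∃ κ₁ κ₂ : ℝ≥0∞, 0 < κ₁ ∧ κ₁ ≤ κ₂ ∧ κ₂ < ∞ ∧ Spec ν s E ⊆ Icc κ₁ κ₂ := by
  obtain ⟨κ₁, hκ₁, hlower⟩ := hν.exists_le_density hf hE hs
  obtain ⟨κ₂, hκ₂, hupper⟩ := hν.exists_density_le hf hE hs hO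
  obtain ⟨x₀, hx₀⟩ := hE.nonempty
  obtain ⟨d, hd₁, hd₂⟩ := (hlower.and hupper).exists
  refine ⟨κ₁, κ₂, pos_iff_ne_zero.2 hκ₁, (hd₁ x₀ hx₀).trans (hd₂ x₀), hκ₂.lt_top, ?_⟩
  rw [Spec_eq_biUnion]
  refine iUnion₂_subset fun x hx => (Spec_singleton_subset_Icc x).trans (Icc_subset_Icc ?_ ?_)
  · exact le_liminf_of_le (by isBoundedDefault) (hlower.mono fun d hd => hd x hx)
  · exact limsup_le_of_le (by isBoundedDefault) (hupper.mono fun d hd => hd x)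

lemma density_mem_Icc_of_genericPoints (hO : IsFeasible f E O) (hx : x ∈ E) (hd : 0 < d)
    (hxO : Metric.closedBall x d ⊆ O) (hy : y ∈ genericPoints f E O) :
    density ν s x d ∈ Icc (lowerDensity ν s y) (upperDensity ν s y) :=
  Spec_singleton_subset_Icc y (hν.density_mem_Spec hf hE ⟨hx, hd, O, hO, hxO⟩ hy.1)

lemma lowerDensity_eq_and_upperDensity_eq (hO : IsFeasible f E O) (hx : x ∈ genericPoints f E O)
    (hy : y ∈ genericPoints f E O) :
    lowerDensity ν s x = lowerDensity ν s y ∧ upperDensity ν s x = upperDensity ν s y := by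
  refine (Icc_eq_Icc_iff (lowerDensity_le_upperDensity x)).1 ?_
  rw [← Spec_singleton_eq_Icc (monotone_measure_closedBall ν x),
    ← Spec_singleton_eq_Icc (monotone_measure_closedBall ν y), hν.Spec_singleton_eq hf hE hO hx,
    hν.Spec_singleton_eq hf hE hO hy]

lemma density_bounds_genericPoints (hs : 0 < s) (hO : IsFeasible f E O)
    (hy : y ∈ genericPoints f E O) : lowerDensity ν s y ≠ 0 ∧ upperDensity ν s y ≠ ∞ := by
  obtain ⟨κ₁, κ₂, hκ₁, -, hκ₂, hκ⟩ := hν.exists_Spec_subset_Icc hf hE hs hO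
  have hIcc := (Spec_mono (singleton_subset_iff.2 hy.2.2)).trans hκ
  rw [Spec_singleton_eq_Icc (monotone_measure_closedBall ν y),
    Icc_subset_Icc_iff (lowerDensity_le_upperDensity y)] at hIcc
  exact ⟨(hκ₁.trans_le hIcc.1).ne', (hIcc.2.trans_lt hκ₂).ne⟩

lemma lowerDensity_ne_top (hs : 0 < s) (hO : IsFeasible f E O) (hy : y ∈ genericPoints f E O) :
    lowerDensity ν s y ≠ ∞ :=
  ne_top_of_le_ne_top (hν.density_bounds_genericPoints hf hE hs hO hy).2
    (lowerDensity_le_upperDensity y)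

lemma upperDensity_ne_zero (hs : 0 < s) (hO : IsFeasible f E O) (hy : y ∈ genericPoints f E O) :
    upperDensity ν s y ≠ 0 :=
  ne_bot_of_le_ne_bot (hν.density_bounds_genericPoints hf hE hs hO hy).1
    (lowerDensity_le_upperDensity y)

theorem centredHausdorff_eq_div (hs : 0 < s) (hO : IsFeasible f E O)
    (hy : y ∈ genericPoints f E O) (hAE : A ⊆ E) (hA : MeasurableSet A) :
    centredHausdorff s A = ν A / upperDensity ν s y := by
  have := hν.isFiniteMeasure
  obtain ⟨c, hc, hcE⟩ := hν.exists_le_density hf hE hs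
  refine le_antisymm ?_ ?_
  · rw [ENNReal.le_div_iff_mul_le (Or.inl (hν.upperDensity_ne_zero hf hE hs hO hy))
      (Or.inl (hν.density_bounds_genericPoints hf hE hs hO hy).2), mul_comm]
    refine mul_centredHausdorff_le hc (fun x hx => ?_) ?_
    · exact (le_liminf_of_le (by isBoundedDefault) (hcE.mono fun d hd => hd x (hAE hx))).trans
        (lowerDensity_le_upperDensity x)
    · filter_upwards [hν.genericPoints_mem_ae hf hE hO] with x hx _
      exact (hν.lowerDensity_eq_and_upperDensity_eq hf hE hO hx hy).2.ge
  · exact measure_div_le_centredHausdorff hA hO.isOpen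
      (measure_mono_null (fun x hx => hx.2) (hν.measure_compl_feasible hf hE hO))
      fun x hx d hd hxO => (hν.density_mem_Icc_of_genericPoints hf hE hO (hAE hx) hd hxO hy).2

theorem packingMeasure_eq_div (hs : 0 < s) (hO : IsFeasible f E O)
    (hy : y ∈ genericPoints f E O) (hAE : A ⊆ E) (hA : MeasurableSet A) :
    packingMeasure s A = ν A / lowerDensity ν s y := by
  have := hν.isFiniteMeasure
  obtain ⟨c, hc, hcE⟩ := hν.exists_le_density hf hE hs
  have hne := hν.lowerDensity_ne_top hf hE hs hO hy
  refine le_antisymm ?_ (measure_div_le_packingMeasure ?_)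
  · rw [ENNReal.le_div_iff_mul_le
      (Or.inl (hν.density_bounds_genericPoints hf hE hs hO hy).1) (Or.inl hne), mul_comm]
    exact mul_packingMeasure_le hE.isCompact.isClosed hAE hc hcE hA hO.isOpen
      (measure_mono_null (fun x hx => hx.2) (hν.measure_compl_feasible hf hE hO)) hne
      fun x hx d hd hxO => (hν.density_mem_Icc_of_genericPoints hf hE hO (hAE hx) hd hxO hy).1
  · filter_upwards [hν.genericPoints_mem_ae hf hE hO] with x hx _
    exact (hν.lowerDensity_eq_and_upperDensity_eq hf hE hO hx hy).1.le

end IsInvariantMeasure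

end Generic

section OuterMeasure

lemma outerMeasure_le_mul_of_closedBall {X : Type*} [MetricSpace X] [SecondCountableTopology X]
    [MeasurableSpace X] [OpensMeasurableSpace X] [HasBesicovitchCovering X] {ν : Measure X}
    [SFinite ν] [ν.OuterRegular] {β : OuterMeasure X} {C : ℝ≥0∞} (hC : C ≠ ∞)
    (h : ∀ x d, β (Metric.closedBall x d) ≤ C * ν (Metric.closedBall x d)) (A : Set X) :
    β A ≤ C * ν A := by
  have happrox (ε : ℝ≥0∞) (hε : ε ≠ 0) : β A ≤ C * (ν A + ε) := by
    obtain ⟨t, ρ, htc, -, -, hcover, hsum⟩ :=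
      Besicovitch.exists_closedBall_covering_tsum_measure_le ν hε (fun _ => univ) A
        (fun x _ δ hδ => ⟨δ / 2, mem_univ _, half_pos hδ, half_lt_self hδ⟩)
    calc β A ≤ ∑' x : t, β (Metric.closedBall x (ρ x)) :=
          (β.mono hcover).trans (measure_biUnion_le β htc _)
      _ ≤ ∑' x : t, C * ν (Metric.closedBall x (ρ x)) := ENNReal.tsum_le_tsum fun x => h x (ρ x)
      _ ≤ C * (ν A + ε) := ENNReal.tsum_mul_left.trans_le (mul_le_mul_right hsum C)
  have hlim : Tendsto (fun ε => C * (ν A + ε)) (𝓝[>] 0) (𝓝 (C * (ν A + 0))) :=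
    ENNReal.Tendsto.const_mul (tendsto_const_nhds.add nhdsWithin_le_nhds) (Or.inr hC)
  rw [add_zero] at hlim
  exact ge_of_tendsto hlim (eventually_nhdsWithin_of_forall fun ε hε => happrox ε (ne_of_gt hε))

lemma outerMeasure_eq_mul_of_le {X : Type*} [MeasurableSpace X] {ν : Measure X}
    [IsFiniteMeasure ν] {β : OuterMeasure X} {C : ℝ≥0∞} (hC : C ≠ ∞)
    (h : ∀ A, β A ≤ C * ν A) (huniv : C * ν univ ≤ β univ) {A : Set X} (hA : MeasurableSet A) :
    β A = C * ν A := by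
  refine (h A).antisymm ?_
  refine (ENNReal.add_le_add_iff_right (ENNReal.mul_ne_top hC (measure_ne_top ν Aᶜ))).1 ?_
  calc C * ν A + C * ν Aᶜ = C * ν univ := by rw [← mul_add, measure_add_measure_compl hA]
    _ ≤ β (A ∪ Aᶜ) := by rwa [union_compl_self]
    _ ≤ β A + β Aᶜ := measure_union_le A Aᶜ
    _ ≤ β A + C * ν Aᶜ := add_le_add_right (h Aᶜ) _

namespace IsInvariantMeasure

section Lipschitz

variable {ι X : Type*} [Fintype ι] [MetricSpace X] [MeasurableSpace X] [BorelSpace X]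
  {f : ι → X → X} {c : ι → ℝ≥0∞} {ν : Measure X} {E : Set X} {β : OuterMeasure X} {C : ℝ≥0∞}
  {q : NNReal}

lemma outerMeasure_inter_le_cthickening (hν : IsInvariantMeasure f c ν)
    (hf : ∀ i, LipschitzWith q (f i)) (hfE : E ⊆ ⋃ i, f i '' E) (hνE : ν Eᶜ = 0)
    (hβ : ∀ i A, β (f i '' A) ≤ c i * β A) (hβE : β E ≤ C * ν univ) {D : ℝ}
    (hD : ∀ x ∈ E, ∀ y ∈ E, dist x y ≤ D) (k : ℕ) (A : Set X) :
    β (A ∩ E) ≤ C * ν (Metric.cthickening (q ^ k * D) A) := by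
  induction k generalizing A with
  | zero =>
    rcases (A ∩ E).eq_empty_or_nonempty with h | ⟨x, hxA, hxE⟩
    · rw [h, measure_empty]
      exact zero_le
    rw [pow_zero, one_mul]
    have hEA : E ⊆ Metric.cthickening D A := fun y hy =>
      Metric.mem_cthickening_of_dist_le y x D A hxA (hD y hy x hxE)
    rw [measure_of_measure_compl_eq_zero (measure_mono_null (compl_subset_compl.2 hEA) hνE)]
    exact (β.mono inter_subset_right).trans hβE
  | succ k ih =>
    have hsub : A ∩ E ⊆ ⋃ i, f i '' (f i ⁻¹' A ∩ E) := by
      rintro x ⟨hxA, hxE⟩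
      obtain ⟨i, y, hy, rfl⟩ := mem_iUnion.1 (hfE hxE)
      exact mem_iUnion.2 ⟨i, y, ⟨hxA, hy⟩, rfl⟩
    have hthick (i : ι) : Metric.cthickening (q ^ k * D) (f i ⁻¹' A) ⊆
        f i ⁻¹' Metric.cthickening (q ^ (k + 1) * D) A := by
      rw [pow_succ', mul_assoc]
      exact mapsTo_cthickening_of_lipschitzWith (hf i) (mapsTo_preimage (f i) A) _
    calc β (A ∩ E) ≤ ∑ i, β (f i '' (f i ⁻¹' A ∩ E)) :=
          (β.mono hsub).trans (measure_iUnion_fintype_le β _)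
      _ ≤ ∑ i, c i * (C * ν (f i ⁻¹' Metric.cthickening (q ^ (k + 1) * D) A)) :=
          Finset.sum_le_sum fun i _ => (hβ i _).trans <| mul_le_mul_right
            ((ih _).trans (mul_le_mul_right (measure_mono (hthick i)) C)) (c i)
      _ = C * ν (Metric.cthickening (q ^ (k + 1) * D) A) := by
          rw [hν.measure_eq_sum (fun i => (hf i).continuous.measurable)
            Metric.isClosed_cthickening.measurableSet, Finset.mul_sum]
          exact Finset.sum_congr rfl fun i _ => mul_left_comm _ _ _

lemma outerMeasure_inter_le (hν : IsInvariantMeasure f c ν) (hq : q < 1)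
    (hf : ∀ i, LipschitzWith q (f i)) (hE : Bornology.IsBounded E) (hfE : E ⊆ ⋃ i, f i '' E)
    (hνE : ν Eᶜ = 0) (hβ : ∀ i A, β (f i '' A) ≤ c i * β A) (hC : C ≠ ∞)
    (hβE : β E ≤ C * ν univ) {K : Set X} (hK : IsClosed K) : β (K ∩ E) ≤ C * ν K := by
  have := hν.isFiniteMeasure
  have hlim : Tendsto (fun k : ℕ => (q : ℝ) ^ k * Metric.diam E) atTop (𝓝 0) := by
    simpa only [zero_mul] using (tendsto_pow_atTop_nhds_zero_of_lt_one q.coe_nonneg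
      (NNReal.coe_lt_one.2 hq)).mul_const (Metric.diam E)
  exact ge_of_tendsto' (ENNReal.Tendsto.const_mul
    ((tendsto_measure_cthickening_of_isClosed ⟨1, one_pos, measure_ne_top _ _⟩ hK).comp hlim)
    (Or.inr hC)) fun k => hν.outerMeasure_inter_le_cthickening hf hfE hνE hβ hβE
      (fun _ hx _ hy => Metric.dist_le_diam_of_mem hE hx hy) k K

theorem outerMeasure_inter_eq [SecondCountableTopology X] [HasBesicovitchCovering X]
    (hν : IsInvariantMeasure f c ν) (hq : q < 1)
    (hf : ∀ i, LipschitzWith q (f i)) (hE : Bornology.IsBounded E) (hfE : E ⊆ ⋃ i, f i '' E)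
    (hνE : ν Eᶜ = 0) (hβ : ∀ i A, β (f i '' A) ≤ c i * β A) (hC : C ≠ ∞)
    (hβE : β E = C * ν univ) {A : Set X} (hA : MeasurableSet A) : β (A ∩ E) = C * ν A := by
  have := hν.isFiniteMeasure
  rw [← OuterMeasure.restrict_apply]
  refine outerMeasure_eq_mul_of_le hC (outerMeasure_le_mul_of_closedBall hC fun x d => ?_) ?_ hA
  · rw [OuterMeasure.restrict_apply]
    exact hν.outerMeasure_inter_le hq hf hE hfE hνE hβ hC hβE.le Metric.isClosed_closedBall
  · rw [OuterMeasure.restrict_apply, univ_inter, hβE]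

end Lipschitz

end IsInvariantMeasure

end OuterMeasure

section SphericalHausdorff

lemma IsBallFamily.iUnion {ι X : Type*} [Countable ι] {δ : ℝ} {T : ι → Set (X × ℝ)}
    (hT : ∀ k, IsBallFamily δ (T k)) : IsBallFamily δ (⋃ k, T k) :=
  ⟨countable_iUnion fun k => (hT k).1, fun p hp => by
    obtain ⟨k, hk⟩ := mem_iUnion.1 hp
    exact (hT k).2 p hk⟩

variable {X Y : Type*} [PseudoMetricSpace X] [PseudoMetricSpace Y] {s δ : ℝ}

lemma Covers.iUnion {ι : Type*} {T : ι → Set (X × ℝ)} {A : ι → Set X}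
    (hT : ∀ k, Covers (T k) (A k)) : Covers (⋃ k, T k) (⋃ k, A k) := by
  rw [Covers, biUnion_iUnion]
  exact iUnion_mono hT

lemma exists_ballFamily_ballSum_le (hδ : 0 < δ) {A : Set X} {c : ℝ≥0∞}
    (hc : sphericalHausdorff s A < c) :
    ∃ T : Set (X × ℝ), IsBallFamily δ T ∧ Covers T A ∧ ballSum s T ≤ c := by
  have h : (⨅ (T : Set (X × ℝ)) (_ : IsBallFamily δ T ∧ Covers T A), ballSum s T) < c :=
    lt_of_le_of_lt (le_iSup₂_of_le δ hδ le_rfl) hc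
  simp only [iInf_lt_iff, exists_prop] at h
  obtain ⟨T, ⟨hT, hTA⟩, hlt⟩ := h
  exact ⟨T, hT, hTA, hlt.le⟩

lemma sphericalHausdorff_iUnion_le (A : ℕ → Set X) :
    sphericalHausdorff s (⋃ k, A k) ≤ ∑' k, sphericalHausdorff s (A k) := by
  refine iSup₂_le fun δ hδ => ENNReal.le_of_forall_pos_le_add fun ε hε hfin => ?_
  obtain ⟨ε', hε', hsum⟩ := ENNReal.exists_pos_sum_of_countable (ENNReal.coe_pos.2 hε).ne' ℕ
  have hA (k : ℕ) : sphericalHausdorff s (A k) < sphericalHausdorff s (A k) + ε' k :=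
    ENNReal.lt_add_right (ne_top_of_le_ne_top hfin.ne (ENNReal.le_tsum k))
      (ENNReal.coe_pos.2 (hε' k)).ne'
  choose T hT hTA hTs using fun k => exists_ballFamily_ballSum_le hδ (hA k)
  calc ⨅ (T : Set (X × ℝ)) (_ : IsBallFamily δ T ∧ Covers T (⋃ k, A k)), ballSum s T
      ≤ ballSum s (⋃ k, T k) := iInf₂_le _ ⟨.iUnion hT, .iUnion hTA⟩
    _ ≤ ∑' k, ballSum s (T k) :=
        ENNReal.tsum_iUnion_le_tsum (fun p : X × ℝ => ENNReal.ofReal (2 * p.2) ^ s) T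
    _ ≤ ∑' k, (sphericalHausdorff s (A k) + ε' k) := ENNReal.tsum_le_tsum hTs
    _ = ∑' k, sphericalHausdorff s (A k) + ∑' k, (ε' k : ℝ≥0∞) := ENNReal.tsum_add
    _ ≤ ∑' k, sphericalHausdorff s (A k) + ε := add_le_add_right hsum.le _

/-- The spherical Hausdorff measure as an outer measure, which gives it access to the lemmas on
finite and countable unions. -/
noncomputable def sphericalHausdorffOuter (s : ℝ) : OuterMeasure X where
  measureOf := sphericalHausdorff s
  empty := by
    refine nonpos_iff_eq_zero.1 (iSup₂_le fun δ _ => ?_)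
    refine (iInf₂_le ∅ ⟨⟨countable_empty, fun p hp => hp.elim⟩, empty_subset _⟩).trans ?_
    simp only [ballSum, tsum_empty, le_refl]
  mono h := iSup₂_mono fun _ _ => le_iInf₂ fun T hT => iInf₂_le T ⟨hT.1, h.trans hT.2⟩
  iUnion_nat A _ := sphericalHausdorff_iUnion_le A

lemma sphericalHausdorff_image_le {g : X → Y} {q : NNReal} (hg : LipschitzWith q g) (hq : q ≠ 0)
    (hs : 0 ≤ s) (A : Set X) :
    sphericalHausdorff s (g '' A) ≤ (q : ℝ≥0∞) ^ s * sphericalHausdorff s A := by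
  have hq₀ : (0 : ℝ) < q := NNReal.coe_pos.2 (pos_iff_ne_zero.2 hq)
  have hqs : (q : ℝ≥0∞) ^ s ≠ 0 := (ENNReal.rpow_pos (by simpa [pos_iff_ne_zero]) (by simp)).ne'
  refine iSup₂_le fun δ hδ => ?_
  refine le_trans ?_ (mul_le_mul_right (le_iSup₂ (δ / q) (div_pos hδ hq₀)) _)
  simp only [ENNReal.mul_iInf_of_ne hqs (ENNReal.rpow_ne_top_of_nonneg hs ENNReal.coe_ne_top)]
  refine le_iInf₂ fun T hT => ?_
  let scale : X × ℝ → Y × ℝ := fun p => (g p.1, q * p.2)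
  have hfamily : IsBallFamily δ (scale '' T) := by
    refine ⟨hT.1.1.image _, ?_⟩
    rintro _ ⟨p, hp, rfl⟩
    obtain ⟨hp₀, hpδ⟩ := hT.1.2 p hp
    rw [le_div_iff₀ hq₀] at hpδ
    exact ⟨mul_pos hq₀ hp₀, by linarith⟩
  have hcovers : Covers (scale '' T) (g '' A) := by
    rintro _ ⟨x, hx, rfl⟩
    obtain ⟨p, hp, hxp⟩ := mem_iUnion₂.1 (hT.2 hx)
    exact mem_iUnion₂.2 ⟨_, mem_image_of_mem _ hp, hg.mapsTo_closedBall p.1 p.2 hxp⟩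
  refine (iInf₂_le _ ⟨hfamily, hcovers⟩).trans ?_
  rw [ballSum, ballSum, ← ENNReal.tsum_mul_left]
  refine (ENNReal.tsum_le_tsum_comp_of_surjective (imageFactorization_surjective (f := scale))
    _).trans_eq (tsum_congr fun p => ?_)
  simp only [imageFactorization, scale]
  rw [mul_left_comm, ENNReal.ofReal_mul q.coe_nonneg, ENNReal.ofReal_coe_nnreal,
    ENNReal.mul_rpow_of_nonneg _ _ hs]

lemma sphericalHausdorff_le_centredPre (A : Set X) : sphericalHausdorff s A ≤ centredPre s A :=
  iSup₂_mono fun _ _ => le_iInf₂ fun T hT => iInf₂_le T ⟨hT.1, hT.2.2⟩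

lemma sphericalHausdorff_le_centredHausdorff {A : Set X} (hA : IsClosed A) :
    sphericalHausdorff s A ≤ centredHausdorff s A :=
  (sphericalHausdorff_le_centredPre A).trans (le_iSup₂_of_le A ⟨subset_rfl, hA⟩ le_rfl)

lemma ediam_closedBall_le (x : X) {d : ℝ} (hd : 0 ≤ d) :
    Metric.ediam (Metric.closedBall x d) ≤ ENNReal.ofReal (2 * d) := by
  rw [← Metric.closedEBall_ofReal hd, ENNReal.ofReal_mul zero_le_two, ENNReal.ofReal_ofNat]
  exact Metric.ediam_closedEBall_le

lemma hausdorffMeasure_le_sphericalHausdorff {X : Type*} [MetricSpace X] [MeasurableSpace X]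
    [BorelSpace X] (hs : 0 ≤ s) (A : Set X) :
    Measure.hausdorffMeasure s A ≤ sphericalHausdorff s A := by
  rw [Measure.hausdorffMeasure_apply]
  refine iSup₂_le fun ε hε => ?_
  obtain ⟨δ, hδ₀, hδ⟩ := ENNReal.lt_iff_exists_nnreal_btwn.1 hε
  refine le_iSup₂_of_le (δ : ℝ) (ENNReal.coe_pos.1 hδ₀) (le_iInf₂ fun T hT => ?_)
  have := hT.1.1.to_subtype
  have := Encodable.ofCountable T
  let ball : T → Set X := fun p => Metric.closedBall p.1.1 p.1.2
  have hdiam (p : T) : Metric.ediam (ball p) ≤ ENNReal.ofReal (2 * p.1.2) :=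
    ediam_closedBall_le _ (hT.1.2 p p.2).1.le
  refine (iInf_le_of_le (fun k => ⋃ p ∈ Encodable.decode₂ T k, ball p) (iInf₂_le ?_ ?_)).trans ?_
  · rw [Encodable.iUnion_decode₂, ← biUnion_eq_iUnion T fun p _ => Metric.closedBall p.1 p.2]
    exact hT.2
  · refine fun k => Encodable.iUnion_decode₂_cases (C := fun t => Metric.ediam t ≤ ε) (by simp) ?_
    exact fun p => (hdiam p).trans (((ENNReal.ofReal_le_ofReal (hT.1.2 p p.2).2).trans_eq
      ENNReal.ofReal_coe_nnreal).trans hδ.le)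
  · rw [tsum_iUnion_decode₂ (fun t : Set X => ⨆ _ : t.Nonempty, Metric.ediam t ^ s) (by simp)]
    exact ENNReal.tsum_le_tsum fun p => iSup_le fun _ => ENNReal.rpow_le_rpow (hdiam p) hs

end SphericalHausdorff

section MassDistribution

variable {X : Type*} [MetricSpace X] [MeasurableSpace X] {μ : Measure X} {c : ℝ≥0∞} {s : ℝ}

lemma exists_measure_le_mul_ediam_rpow (hc : c ≠ ∞) (hs : 0 ≤ s)
    (h : ∀ᶠ d in 𝓝[>] 0, ∀ x, density μ s x d ≤ c) :
    ∃ ε > 0, ∀ U : Set X, Metric.ediam U ≤ ε → μ U ≤ c * 2 ^ s * Metric.ediam U ^ s := by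
  obtain ⟨δ, hδ, h⟩ := mem_nhdsGT_iff_exists_Ioc_subset.1 h
  refine ⟨ENNReal.ofReal (δ / 2), ENNReal.ofReal_pos.2 (half_pos hδ), fun U hU => ?_⟩
  rcases U.eq_empty_or_nonempty with rfl | ⟨x, hx⟩
  · simp only [measure_empty, zero_le]
  have hU_top : Metric.ediam U ≠ ∞ := ne_top_of_le_ne_top ENNReal.ofReal_ne_top hU
  have hball (d : ℝ) (hd : Metric.diam U < d) (hdδ : d ≤ δ) :
      μ U ≤ c * ENNReal.ofReal (2 * d) ^ s := by
    refine (measure_mono fun y hy => ?_).trans ((density_le_iff (Metric.diam_nonneg.trans_lt hd)).1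
      (h ⟨Metric.diam_nonneg.trans_lt hd, hdδ⟩ x))
    exact (Metric.dist_le_diam_of_mem (Metric.isBounded_iff_ediam_ne_top.2 hU_top) hy hx).trans
      hd.le
  have hdiam : Metric.diam U < δ :=
    (ENNReal.toReal_le_of_le_ofReal (half_pos hδ).le hU).trans_lt (half_lt_self hδ)
  have hlim : Tendsto (fun d => c * ENNReal.ofReal (2 * d) ^ s) (𝓝[>] Metric.diam U)
      (𝓝 (c * ENNReal.ofReal (2 * Metric.diam U) ^ s)) :=
    ENNReal.Tendsto.const_mul (((ENNReal.continuous_rpow_const.comp (ENNReal.continuous_ofReal.comp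
      (continuous_const.mul continuous_id))).tendsto _).mono_left nhdsWithin_le_nhds) (Or.inr hc)
  have hμU : μ U ≤ c * ENNReal.ofReal (2 * Metric.diam U) ^ s := ge_of_tendsto hlim <| by
    filter_upwards [Ioc_mem_nhdsGT hdiam] with d hd using hball d hd.1 hd.2
  rwa [ENNReal.ofReal_mul zero_le_two, Metric.diam, ENNReal.ofReal_toReal hU_top,
    ENNReal.mul_rpow_of_nonneg _ _ hs, ENNReal.ofReal_ofNat, ← mul_assoc] at hμU

theorem hausdorffMeasure_ne_zero_of_density_le [BorelSpace X] (hc : c ≠ ∞) (hs : 0 ≤ s)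
    (h : ∀ᶠ d in 𝓝[>] 0, ∀ x, density μ s x d ≤ c) {A : Set X} (hA : μ A ≠ 0) :
    Measure.hausdorffMeasure s A ≠ 0 := by
  obtain ⟨ε, hε, hU⟩ := exists_measure_le_mul_ediam_rpow hc hs h
  have hC : c * 2 ^ s + 1 ≠ ∞ :=
    ENNReal.add_ne_top.2 ⟨ENNReal.mul_ne_top hc (ENNReal.rpow_ne_top_of_nonneg hs (by simp)),
      ENNReal.one_ne_top⟩
  have hle : (c * 2 ^ s + 1)⁻¹ • μ ≤ Measure.hausdorffMeasure s :=
    Measure.le_hausdorffMeasure s _ ε hε fun U hUε => by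
      rw [Measure.smul_apply, smul_eq_mul, ENNReal.inv_mul_le_iff (by simp) hC]
      exact (hU U hUε).trans (mul_le_mul_left le_self_add _)
  refine fun hzero => mul_ne_zero (ENNReal.inv_ne_zero.2 hC) hA ?_
  exact nonpos_iff_eq_zero.1 ((hle A).trans_eq hzero)

end MassDistribution

section MetricMeasures

variable {n m : ℕ} {f : Fin m → EuclideanSpace ℝ (Fin n) → EuclideanSpace ℝ (Fin n)}
  {r : Fin m → ℝ} {s : ℝ} {E O : Set (EuclideanSpace ℝ (Fin n))}
  {μ ν : Measure (EuclideanSpace ℝ (Fin n))} {y : EuclideanSpace ℝ (Fin n)}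

lemma IsSimilitudeSystem.coe_toNNReal_rpow (hf : IsSimilitudeSystem f r) (s : ℝ) (i : Fin m) :
    ((r i).toNNReal : ℝ≥0∞) ^ s = similarityWeight r s i :=
  ENNReal.ofReal_rpow_of_pos (hf i).1

lemma IsSimilitudeSystem.hausdorffMeasure_image_le (hf : IsSimilitudeSystem f r) (hs : 0 ≤ s)
    (i : Fin m) (A : Set (EuclideanSpace ℝ (Fin n))) :
    Measure.hausdorffMeasure s (f i '' A) ≤
      similarityWeight r s i * Measure.hausdorffMeasure s A := by
  rw [← hf.coe_toNNReal_rpow]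
  exact (hf.isSimilitude i).lipschitzWith.hausdorffMeasure_image_le hs A

lemma IsSimilitudeSystem.sphericalHausdorff_image_le (hf : IsSimilitudeSystem f r) (hs : 0 ≤ s)
    (i : Fin m) (A : Set (EuclideanSpace ℝ (Fin n))) :
    sphericalHausdorff s (f i '' A) ≤ similarityWeight r s i * sphericalHausdorff s A := by
  rw [← hf.coe_toNNReal_rpow]
  exact SelfSimilarSpectrum.sphericalHausdorff_image_le (hf.isSimilitude i).lipschitzWith
    (Real.toNNReal_pos.2 (hf i).1).ne' hs A

namespace IsInvariantMeasure

variable (hf : IsSimilitudeSystem f r) (hE : IsSelfSimilarSet f E)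
  (hν : IsInvariantMeasure f (similarityWeight r s) ν)

include hf hE hν

lemma measure_attractor : ν E = ν univ :=
  measure_of_measure_compl_eq_zero (hν.measure_compl_attractor hf hE)

lemma measure_attractor_ne_zero : ν E ≠ 0 := by
  rw [hν.measure_attractor hf hE]
  exact Measure.measure_univ_ne_zero.2 hν.ne_zero

lemma div_centredHausdorff_attractor (hs : 0 < s) (hO : IsFeasible f E O)
    (hy : y ∈ genericPoints f E O) : ν E / centredHausdorff s E = upperDensity ν s y := by
  have := hν.isFiniteMeasure
  rw [hν.centredHausdorff_eq_div hf hE hs hO hy Subset.rfl hE.isCompact.measurableSet]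
  exact ENNReal.div_div_cancel (hν.measure_attractor_ne_zero hf hE) (measure_ne_top ν E)

lemma div_packingMeasure_attractor (hs : 0 < s) (hO : IsFeasible f E O)
    (hy : y ∈ genericPoints f E O) : ν E / packingMeasure s E = lowerDensity ν s y := by
  have := hν.isFiniteMeasure
  rw [hν.packingMeasure_eq_div hf hE hs hO hy Subset.rfl hE.isCompact.measurableSet]
  exact ENNReal.div_div_cancel (hν.measure_attractor_ne_zero hf hE) (measure_ne_top ν E)

lemma hausdorffMeasure_attractor_ne_zero (hs : 0 < s) (hO : IsFeasible f E O) :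
    Measure.hausdorffMeasure s E ≠ 0 := by
  obtain ⟨c, hc, hcE⟩ := hν.exists_density_le hf hE hs hO
  exact hausdorffMeasure_ne_zero_of_density_le hc hs.le hcE (hν.measure_attractor_ne_zero hf hE)

lemma sphericalHausdorff_attractor_ne_top (hs : 0 < s) (hO : IsFeasible f E O)
    (hy : y ∈ genericPoints f E O) : sphericalHausdorff s E ≠ ∞ := by
  have := hν.isFiniteMeasure
  refine ne_top_of_le_ne_top ?_ (sphericalHausdorff_le_centredHausdorff hE.isCompact.isClosed)
  rw [hν.centredHausdorff_eq_div hf hE hs hO hy Subset.rfl hE.isCompact.measurableSet]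
  exact ENNReal.div_ne_top (measure_ne_top ν E) (hν.upperDensity_ne_zero hf hE hs hO hy)

end IsInvariantMeasure

namespace IsNaturalMeasure

lemma outerMeasure_inter_eq (hf : IsSimilitudeSystem f r) (hE : IsSelfSimilarSet f E)
    (hμ : IsNaturalMeasure f r s μ) {β : OuterMeasure (EuclideanSpace ℝ (Fin n))}
    (hβ : ∀ i A, β (f i '' A) ≤ similarityWeight r s i * β A) (hβE : β E ≠ ∞)
    {A : Set (EuclideanSpace ℝ (Fin n))} (hA : MeasurableSet A) :
    β (A ∩ E) = (β E • μ) A := by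
  have := hμ.isProbabilityMeasure
  obtain ⟨q, -, hq, hrq⟩ := hf.exists_ratio_upperBound
  exact hμ.isInvariantMeasure.outerMeasure_inter_eq (Real.toNNReal_lt_one.2 hq)
    (fun i => (hf.isSimilitude i).lipschitzWith.weaken (Real.toNNReal_mono (hrq i)))
    hE.isCompact.isBounded hE.eq_iUnion.subset (hμ.isInvariantMeasure.measure_compl_attractor hf hE)
    hβ hβE (by rw [measure_univ, mul_one]) hA

theorem exists_eq_isInvariantMeasure (hf : IsSimilitudeSystem f r) (hE : IsSelfSimilarSet f E)
    (hμ : IsNaturalMeasure f r s μ) (hO : IsFeasible f E O) (hs : 0 < s)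
    {α : Set (EuclideanSpace ℝ (Fin n)) → ℝ≥0∞} (hα : α ∈ metricMeasures s E μ) :
    ∃ ν, IsInvariantMeasure f (similarityWeight r s) ν ∧ ∀ A, MeasurableSet A → α A = ν A := by
  have hν := hμ.isInvariantMeasure
  have := hμ.isProbabilityMeasure
  obtain ⟨y, hy⟩ := hν.nonempty_genericPoints hf hE hO
  obtain ⟨hlower, hupper⟩ := hν.density_bounds_genericPoints hf hE hs hO hy
  have hHausdorff := hν.hausdorffMeasure_attractor_ne_zero hf hE hs hO
  have hle := hausdorffMeasure_le_sphericalHausdorff hs.le E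
  have hspherical := hν.sphericalHausdorff_attractor_ne_top hf hE hs hO hy
  have hAE (A : Set (EuclideanSpace ℝ (Fin n))) : μ (A ∩ E) = μ A :=
    measure_inter_conull (hν.measure_compl_attractor hf hE)
  rcases hα with rfl | rfl | rfl | rfl | rfl
  · exact ⟨μ, hν, fun _ _ => rfl⟩
  · have hfin := ne_top_of_le_ne_top hspherical hle
    exact ⟨_, hν.smul hHausdorff hfin, fun _ => hμ.outerMeasure_inter_eq hf hE
      (β := (Measure.hausdorffMeasure s).toOuterMeasure) (hf.hausdorffMeasure_image_le hs.le) hfin⟩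
  · exact ⟨_, hν.smul (ne_bot_of_le_ne_bot hHausdorff hle) hspherical, fun _ =>
      hμ.outerMeasure_inter_eq hf hE (β := sphericalHausdorffOuter s)
        (hf.sphericalHausdorff_image_le hs.le) hspherical⟩
  · refine ⟨_, hν.smul (ENNReal.inv_ne_zero.2 hupper)
      (ENNReal.inv_ne_top.2 (hν.upperDensity_ne_zero hf hE hs hO hy)), fun A hA => ?_⟩
    beta_reduce
    rw [hν.centredHausdorff_eq_div hf hE hs hO hy inter_subset_right
      (hA.inter hE.isCompact.measurableSet), hAE, ENNReal.div_eq_inv_mul]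
    rfl
  · refine ⟨_, hν.smul (ENNReal.inv_ne_zero.2 (hν.lowerDensity_ne_top hf hE hs hO hy))
      (ENNReal.inv_ne_top.2 hlower), fun A hA => ?_⟩
    beta_reduce
    rw [hν.packingMeasure_eq_div hf hE hs hO hy inter_subset_right
      (hA.inter hE.isCompact.measurableSet), hAE, ENNReal.div_eq_inv_mul]
    rfl

end IsNaturalMeasure

end MetricMeasures

section Congr

variable {X : Type*} [PseudoMetricSpace X] {α β : Set X → ℝ≥0∞} {s : ℝ}

lemma lowerDensity_congr (h : density α s = density β s) : lowerDensity α s = lowerDensity β s := by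
  funext x
  simp only [lowerDensity, h]

lemma upperDensity_congr (h : density α s = density β s) : upperDensity α s = upperDensity β s := by
  funext x
  simp only [upperDensity, h]

lemma Spec_congr (h : density α s = density β s) : Spec α s = Spec β s := by
  funext A
  simp only [Spec, h]

lemma typicalDensities_congr {n m : ℕ}
    {f : Fin m → EuclideanSpace ℝ (Fin n) → EuclideanSpace ℝ (Fin n)}
    {E : Set (EuclideanSpace ℝ (Fin n))} {α β : Set (EuclideanSpace ℝ (Fin n)) → ℝ≥0∞}
    (h : density α s = density β s) : typicalDensities f E α s = typicalDensities f E β s := by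
  simp only [typicalDensities, h]

end Congr

end SelfSimilarSpectrum

theorem theorem3p8 {n m : ℕ}
    (f : Fin m → EuclideanSpace ℝ (Fin n) → EuclideanSpace ℝ (Fin n)) (r : Fin m → ℝ)
    (hf : SelfSimilarSpectrum.IsSimilitudeSystem f r)
    (E : Set (EuclideanSpace ℝ (Fin n))) (hE : SelfSimilarSpectrum.IsSelfSimilarSet f E)
    (O : Set (EuclideanSpace ℝ (Fin n))) (hO : SelfSimilarSpectrum.IsFeasible f E O)
    (s : ℝ) (hs : 0 < s) (hdim : ∑ i, r i ^ s = 1)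
    (μ : Measure (EuclideanSpace ℝ (Fin n)))
    (hμ : SelfSimilarSpectrum.IsNaturalMeasure f r s μ)
    (α : Set (EuclideanSpace ℝ (Fin n)) → ℝ≥0∞)
    (hα : α ∈ SelfSimilarSpectrum.metricMeasures s E μ) :
    -- (i)
    ((∀ x ∈ E, SelfSimilarSpectrum.Spec α s {x} =
        Set.Icc (SelfSimilarSpectrum.lowerDensity α s x)
          (SelfSimilarSpectrum.upperDensity α s x)) ∧
      ∃ κ₁ κ₂ : ℝ≥0∞, 0 < κ₁ ∧ κ₁ ≤ κ₂ ∧ κ₂ < ∞ ∧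
        SelfSimilarSpectrum.Spec α s E ⊆ Set.Icc κ₁ κ₂) ∧
    -- (ii)
    (∃ Ehat : Set (EuclideanSpace ℝ (Fin n)), Ehat ⊆ E ∧ MeasurableSet Ehat ∧ μ Ehat = 1 ∧
      ∀ y ∈ Ehat,
        SelfSimilarSpectrum.Spec α s {y} = SelfSimilarSpectrum.Spec α s Ehat ∧
        SelfSimilarSpectrum.Spec α s Ehat = SelfSimilarSpectrum.Spec α s (O ∩ E)) ∧
    -- (iii)
    (Set.Ioo (α E / SelfSimilarSpectrum.packingMeasure s E)
          (α E / SelfSimilarSpectrum.centredHausdorff s E)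
        ⊆ SelfSimilarSpectrum.typicalDensities f E α s ∧
      SelfSimilarSpectrum.typicalDensities f E α s ⊆ SelfSimilarSpectrum.Spec α s (O ∩ E) ∧
      SelfSimilarSpectrum.Spec α s (O ∩ E) ⊆
        Set.Icc (α E / SelfSimilarSpectrum.packingMeasure s E)
          (α E / SelfSimilarSpectrum.centredHausdorff s E)) := by
  have := hμ.isProbabilityMeasure
  obtain ⟨ν, hν, hαν⟩ := hμ.exists_eq_isInvariantMeasure hf hE hO hs hα
  have hgeneric := hμ.isInvariantMeasure.genericPoints_mem_ae hf hE hO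
  have hmeas := SelfSimilarSpectrum.measurableSet_genericPoints hf hE hO
  obtain ⟨y, hy⟩ := hν.nonempty_genericPoints hf hE hO
  have hdensity : SelfSimilarSpectrum.density α s = SelfSimilarSpectrum.density ν s :=
    funext₂ fun x d => congrArg (· / _) (hαν _ Metric.isClosed_closedBall.measurableSet)
  rw [SelfSimilarSpectrum.Spec_congr hdensity, SelfSimilarSpectrum.lowerDensity_congr hdensity,
    SelfSimilarSpectrum.upperDensity_congr hdensity,
    SelfSimilarSpectrum.typicalDensities_congr hdensity, hαν E hE.isCompact.measurableSet,
    hν.div_centredHausdorff_attractor hf hE hs hO hy,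
    hν.div_packingMeasure_attractor hf hE hs hO hy]
  refine ⟨⟨fun x _ => SelfSimilarSpectrum.Spec_singleton_eq_Icc
      (SelfSimilarSpectrum.monotone_measure_closedBall ν x),
    hν.exists_Spec_subset_Icc hf hE hs hO⟩,
    ⟨SelfSimilarSpectrum.genericPoints f E O, inter_subset_right.trans inter_subset_right, hmeas,
      (prob_compl_eq_zero_iff hmeas).1 hgeneric, fun z hz => ?_⟩,
    hO.Ioo_subset_typicalDensities hy.2, ?_, ?_⟩
  · rw [hν.Spec_genericPoints_eq hf hE hO hz]
    exact ⟨hν.Spec_singleton_eq hf hE hO hz, rfl⟩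
  · rw [← hν.Spec_singleton_eq hf hE hO hy]
    exact hν.typicalDensities_subset_Spec hf hE hy.1
  · rw [← hν.Spec_singleton_eq hf hE hO hy]
    exact SelfSimilarSpectrum.Spec_singleton_subset_Icc y
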